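/- **Theorem (detached empirical CVaR gives a consistent tail-gradient estimator).** For a random variable $X$ on a probability space and $\alpha\in(0,1)$ write $\operatorname{VaR}_\alpha(X)=\inf\{t\in\mathbb R:\mathbb P[X\le t]\ge\alpha\}$ and $\operatorname{CVaR}_\alpha(X)=\inf_{\eta\in\mathbb R}\bigl[\eta+\tfrac1{1-\alpha}\mathbb E(X-\eta)_+\bigr]$. For a sample $x_1,\dots,x_B$ write $\widehat Q_\alpha(x)=\inf\{t:\tfrac1B\#\{i:x_i\le t\}\ge\alpha\}$ and $\widehat{\operatorname{CVaR}}_\alpha(x)=\widehat Q_\alpha(x)+\tfrac1{(1-\alpha)B}\sum_{i=1}^B(x_i-\widehat Q_\alpha(x))_+$. *(Gradient.)* Let $\xi$ be a random element with law $\mu$, let $\Theta\subseteq\mathbb R^d$ be open, $\theta\in\Theta$, $\alpha\in(0,1)$, $G\in\mathbb R$, and let $J_\tau(\xi)$, $\tau\in\Theta$, be real random variables with $\mathbb E[(J_\theta(\xi))_+]<\infty$. Assume: 1. almost surely, $\tau\mapsto J_\tau(\xi)$ is differentiable at every $\tau\in\Theta$; 2. almost surely, $\|\nabla_\tau J_\tau(\xi)\|\le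 G$ for every $\tau\in\Theta$; 3. the law of $J_\theta(\xi)$ has a continuous density on an open interval around $\eta_\alpha:=\operatorname{VaR}_\alpha(J_\theta)$; 4. $\mathbb P[J_\theta(\xi)=\eta_\alpha]=0$. Then $\nabla_\theta J_\theta(\xi)\mathbf 1\{J_\theta(\xi)\ge\eta_\alpha\}$ is integrable, $\tau\mapsto\operatorname{CVaR}_\alpha(J_\tau)$ is differentiable at $\theta$, and $$\nabla_\theta\operatorname{CVaR}_\alpha(J_\theta)=\frac1{1-\alpha}\mathbb E\bigl[\nabla_\theta J_\theta(\xi)\,\mathbf 1\{J_\theta(\xi)\ge\eta_\alpha\}\bigr].$$ *(Estimator.)* Let moreover $\xi_1,\xi_2,\dots$ be i.i.d. with law $\mu$, and put $J^{(i)}_\theta=J_\theta(\xi_i)$, $\widehat\eta=\widehat Q_\alpha(J^{(1)}_\theta,\dots,J^{(B)}_\theta)$ and $$\widehat g_B(\theta)=\frac1{(1-\alpha)B}\sum_{i=1}^B\nabla_\theta J^{(i)}_\theta\,\mathbf 1\{J^{(i)}_\theta\ge\widehat\eta\}.$$ Then $\widehat g_B(\theta)\to\nabla_\theta\operatorname{CVaR}_\alpha(J_\theta)$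 almost surely as $B\to\infty$, and $\|\widehat g_B(\theta)-\nabla_\theta\operatorname{CVaR}_\alpha(J_\theta)\|=O_p(B^{-1/2})$. *(Value.)* For every $\delta_0\in(0,1)$ there is a constant $C>0$ depending only on $\delta_0$ such that, for every $\alpha\in(0,1)$, every random variable $X$ with values almost surely in $[0,J_{\max}]$ (in particular $X=J_\theta$), every $B\ge1$, every i.i.d. sample $X_1,\dots,X_B$ of copies of $X$ and every $\delta\in(0,\delta_0]$, with probability at least $1-\delta$, $$\bigl|\widehat{\operatorname{CVaR}}_\alpha(X_1,\dots,X_B)-\operatorname{CVaR}_\alpha(X)\bigr|\le C\,\frac{J_{\max}}{1-\alpha}\sqrt{\frac{\log(1/\delta)}{B}}.$$ -/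

import Mathlib

open MeasureTheory ProbabilityTheory Filter Topology

noncomputable section

/-- Value at risk: the `α`-quantile `inf {t | α ≤ μ(X ≤ t)}` of the random variable `X`. -/
def VaR {Ξ : Type*} [MeasurableSpace Ξ] (α : ℝ) (X : Ξ → ℝ) (μ : Measure Ξ) : ℝ :=
  sInf {t : ℝ | α ≤ μ.real {ξ | X ξ ≤ t}}

/-- Conditional value at risk in the Rockafellar--Uryasev form
`inf_η (η + (1 - α)⁻¹ E (X - η)₊)`. -/
def CVaR {Ξ : Type*} [MeasurableSpace Ξ] (α : ℝ) (X : Ξ → ℝ) (μ : Measure Ξ) : ℝ :=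
  ⨅ η : ℝ, (η + 1 / (1 - α) * ∫ ξ, max (X ξ - η) 0 ∂μ)

/-- The measure `ν` on the line has a continuous density on some open interval around `x`. -/
def HasContinuousDensityNear (ν : Measure ℝ) (x : ℝ) : Prop :=
  ∃ ε : ℝ, 0 < ε ∧ ∃ f : ℝ → ℝ, ContinuousOn f (Set.Ioo (x - ε) (x + ε)) ∧
    (∀ t ∈ Set.Ioo (x - ε) (x + ε), 0 ≤ f t) ∧
    ∀ s ⊆ Set.Ioo (x - ε) (x + ε), MeasurableSet s → ν s = ∫⁻ t in s, ENNReal.ofReal (f t)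

/-- The empirical `α`-quantile `inf {t | α ≤ #{i | x i ≤ t} / B}` of a sample of size `B`. -/
def empQuantile (α : ℝ) {B : ℕ} (x : Fin B → ℝ) : ℝ :=
  sInf {t : ℝ | α ≤ ((Finset.univ.filter fun i => x i ≤ t).card : ℝ) / B}

/-- The empirical CVaR value of a sample `x`: the Rockafellar--Uryasev objective of the sample,
evaluated at the empirical quantile. -/
def empCVaR (α : ℝ) {B : ℕ} (x : Fin B → ℝ) : ℝ :=
  empQuantile α x + 1 / ((1 - α) * B) * ∑ i, max (x i - empQuantile α x) 0

/-- The detached-quantile gradient estimator at the parameter `θ`, for the cost `J` and the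
rollouts `ξ i`: the empirical quantile is treated as a constant when differentiating in `θ`. -/
def tailGradEstimator {d : ℕ} {Ξ : Type*} (α : ℝ) (J : EuclideanSpace ℝ (Fin d) → Ξ → ℝ)
    (θ : EuclideanSpace ℝ (Fin d)) {B : ℕ} (ξ : Fin B → Ξ) : EuclideanSpace ℝ (Fin d) :=
  (1 / ((1 - α) * B)) •
    ∑ i, if empQuantile α (fun j => J θ (ξ j)) ≤ J θ (ξ i)
      then gradient (fun τ => J τ (ξ i)) θ else 0

/-- `X n = O_p(r n)` as `n → ∞`. -/
def IsBigOInProb {Ω E : Type*} [MeasurableSpace Ω] [Norm E] (P : Measure Ω)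
    (X : ℕ → Ω → E) (r : ℕ → ℝ) : Prop :=
  ∀ ε : ℝ, 0 < ε → ∃ M : ℝ, ∀ᶠ n in atTop, P.real {ω | M * r n < ‖X n ω‖} ≤ ε

end

/-!
Throughout, `q` is the value at risk of the cost `X = J θ`. Everything rests on a *tail weight*
`z` (`IsTailWeight`): `0 ≤ z ≤ 1`, `z` is `1` above `q` and `0` below, and an atom at `q` is split
so that `E z(X) = 1 - α`. The pointwise inequality
`(x - q)₊ + z(x) (y - x) + z(x) (q - η) ≤ (y - η)₊` (`IsTailWeight.le_max`) integrates to weak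
duality (`IsTailWeight.le_objective`), which shows that `q` minimizes the Rockafellar--Uryasev
objective of `X` and bounds the objective of every other cost `Y` from below, uniformly in the
threshold `η`. An empirical quantile is the value at risk under the uniform measure on the
sample, so that the same facts hold for samples.

*Gradient.* Near `θ`, `CVaR α (J τ)` lies between
`CVaR α (J θ) + (1 - α)⁻¹ E [z(J θ) (J τ - J θ)]` (weak duality) and the objective of `J τ` at the
fixed threshold `q`. Both bounds are exact at `τ = θ`, and differentiation under the integral sign
gives both the same gradient there, so `CVaR` has that gradient as well (`hasGradientAt_CVaR`).

*Estimator.* Replacing the true quantile by the empirical one changes the tail sum by at most `G`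
times the number of sample points between the two. Strictly below the empirical quantile
there are at most `α B` points, and at least `α B - 1` unless it is a tied value. Ties matter only
if the empirical quantile is below `q`; it is then eventually close to `q`, where the density
excludes ties. Hence the number of points crossed is at most `|#{X < q} - α B| + 1`
(`abs_card_lt_empQuantile_sub_le`), and consistency and rate follow from the strong law and from
Hoeffding's inequality for sample means of fixed functions, with no rate of convergence of the
empirical quantile.

*Value.* With `η` the empirical quantile, the same pointwise inequality applied to the sample puts
the empirical CVaR between the empirical objective at `q` and the latter minus
`|η - q| |1 - mean z / (1 - α)|`. It therefore suffices to control the sample means of the two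
bounded functions `(X - q)₊` and `z(X)` by Hoeffding's inequality (`abs_empCVaR_sub_le`).
-/

/-! ### Tail weights -/

section TailWeight

variable {Ξ : Type*} [MeasurableSpace Ξ] {μ : Measure Ξ} {X : Ξ → ℝ} {α q : ℝ} {z : ℝ → ℝ}

/-- A tail weight at the quantile `q`: it equals `1` above `q` and `0` below `q`, and splits an atom
at `q` so that its mean is exactly `1 - α`. The values off `q` are encoded by the single equation
`mul_sub`, which is the form used below. The function is `1 - α` times the extremal density of the
dual representation of `CVaR`. -/
structure IsTailWeight (α q : ℝ) (X : Ξ → ℝ) (μ : Measure Ξ) (z : ℝ → ℝ) : Prop where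
  measurable : Measurable z
  nonneg : ∀ x, 0 ≤ z x
  le_one : ∀ x, z x ≤ 1
  mul_sub : ∀ x, z x * (x - q) = max (x - q) 0
  integral_eq : ∫ ξ, z (X ξ) ∂μ = 1 - α

lemma IsTailWeight.eq_one (hz : IsTailWeight α q X μ z) {x : ℝ} (hx : q < x) : z x = 1 := by
  have h := hz.mul_sub x
  rw [max_eq_left (by linarith)] at h
  exact mul_right_cancel₀ (sub_ne_zero.2 hx.ne') (h.trans (one_mul _).symm)

lemma IsTailWeight.eq_zero (hz : IsTailWeight α q X μ z) {x : ℝ} (hx : x < q) : z x = 0 := by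
  have h := hz.mul_sub x
  rw [max_eq_right (by linarith)] at h
  exact (mul_eq_zero.1 h).resolve_right (sub_ne_zero.2 hx.ne)

/-- A tail weight at `q` bounds every hinge `(y - η)₊` from below by a function affine in `y`
and `η`; equality holds for `y = x`, `η = q`. -/
lemma IsTailWeight.le_max (hz : IsTailWeight α q X μ z) (x y η : ℝ) :
    max (x - q) 0 + z x * (y - x) + z x * (q - η) ≤ max (y - η) 0 := by
  rw [← hz.mul_sub]
  have h : z x * (y - η) ≤ max (y - η) 0 := by
    rcases le_total 0 (y - η) with h | h
    · rw [max_eq_left h]; exact mul_le_of_le_one_left h (hz.le_one x)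
    · rw [max_eq_right h]; exact mul_nonpos_of_nonneg_of_nonpos (hz.nonneg x) h
  linarith

end TailWeight

/-! ### Quantiles and the Rockafellar--Uryasev objective -/

section Quantile

variable {Ξ : Type*} [MeasurableSpace Ξ] {μ : Measure Ξ} [IsProbabilityMeasure μ] {X Y : Ξ → ℝ}
  {α : ℝ}

lemma cdf_map_eq_real (hX : Measurable X) (t : ℝ) : cdf (μ.map X) t = μ.real {ξ | X ξ ≤ t} := by
  have := Measure.isProbabilityMeasure_map (μ := μ) hX.aemeasurable
  rw [cdf_eq_real, map_measureReal_apply hX measurableSet_Iic]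
  rfl

lemma bddBelow_setOf_le_real (hX : Measurable X) (hα : 0 < α) :
    BddBelow {t : ℝ | α ≤ μ.real {ξ | X ξ ≤ t}} := by
  obtain ⟨a, ha⟩ := ((tendsto_cdf_atBot (μ.map X)).eventually (gt_mem_nhds hα)).exists
  refine ⟨a, fun t ht => ?_⟩
  by_contra! h
  have := monotone_cdf (μ.map X) h.le
  simp only [cdf_map_eq_real hX] at this ha
  exact absurd (ht.trans this) (not_le.2 ha)

lemma nonempty_setOf_le_real (hX : Measurable X) (hα : α < 1) :
    {t : ℝ | α ≤ μ.real {ξ | X ξ ≤ t}}.Nonempty := by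
  obtain ⟨a, ha⟩ := ((tendsto_cdf_atTop (μ.map X)).eventually (lt_mem_nhds hα)).exists
  rw [cdf_map_eq_real hX] at ha
  exact ⟨a, ha.le⟩

lemma VaR_le_of_le_real (hX : Measurable X) (hα : 0 < α) {t : ℝ}
    (ht : α ≤ μ.real {ξ | X ξ ≤ t}) : VaR α X μ ≤ t :=
  csInf_le (bddBelow_setOf_le_real hX hα) ht

lemma real_le_lt_of_lt_VaR (hX : Measurable X) (hα : 0 < α) {t : ℝ} (ht : t < VaR α X μ) :
    μ.real {ξ | X ξ ≤ t} < α := by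
  by_contra! h
  exact absurd (VaR_le_of_le_real hX hα h) (not_le.2 ht)

lemma le_real_le_VaR (hX : Measurable X) (hα1 : α < 1) :
    α ≤ μ.real {ξ | X ξ ≤ VaR α X μ} := by
  rw [← cdf_map_eq_real hX]
  have hc : Tendsto (cdf (μ.map X)) (𝓝[>] VaR α X μ) (𝓝 (cdf (μ.map X) (VaR α X μ))) :=
    ((cdf (μ.map X)).right_continuous _).mono Set.Ioi_subset_Ici_self
  refine ge_of_tendsto hc ?_
  filter_upwards [self_mem_nhdsWithin] with t ht
  obtain ⟨s, hs, hst⟩ := exists_lt_of_csInf_lt (nonempty_setOf_le_real (μ := μ) hX hα1) ht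
  rw [cdf_map_eq_real hX]
  exact le_trans hs (measureReal_mono fun ξ hξ => le_trans hξ hst.le)

lemma real_lt_VaR_le (hX : Measurable X) (hα : 0 < α) :
    μ.real {ξ | X ξ < VaR α X μ} ≤ α := by
  have := Measure.isProbabilityMeasure_map (μ := μ) hX.aemeasurable
  have h1 : μ.real {ξ | X ξ < VaR α X μ} = (μ.map X).real (Set.Iio (VaR α X μ)) := by
    rw [map_measureReal_apply hX measurableSet_Iio]; rfl
  rw [h1, measureReal_def, ← measure_cdf (μ.map X),
    StieltjesFunction.measure_Iio _ (tendsto_cdf_atBot (μ.map X)), sub_zero]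
  refine ENNReal.toReal_le_of_le_ofReal hα.le (ENNReal.ofReal_le_ofReal ?_)
  refine le_of_tendsto ((monotone_cdf (μ.map X)).tendsto_leftLim _) ?_
  filter_upwards [self_mem_nhdsWithin] with t ht
  rw [cdf_map_eq_real hX]
  exact (real_le_lt_of_lt_VaR hX hα ht).le

lemma exists_isTailWeight (hX : Measurable X) (hα : 0 < α) (hα1 : α < 1) :
    ∃ z, IsTailWeight α (VaR α X μ) X μ z := by
  set q := VaR α X μ
  have hle : α ≤ μ.real {ξ | X ξ ≤ q} := le_real_le_VaR hX hα1
  have hlt : μ.real {ξ | X ξ < q} ≤ α := real_lt_VaR_le hX hα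
  set p := μ.real {ξ | X ξ = q}
  have hmeq : MeasurableSet {ξ | X ξ = q} := hX (measurableSet_singleton q)
  have hsum : μ.real {ξ | X ξ ≤ q} = μ.real {ξ | X ξ < q} + p := by
    rw [← measureReal_union _ hmeq]
    · congr 1; ext ξ; exact le_iff_lt_or_eq (a := X ξ)
    · exact Set.disjoint_left.2 fun ξ (h : X ξ < q) h' => h.ne h'
  have hp0 : 0 ≤ p := measureReal_nonneg
  set l := (μ.real {ξ | X ξ ≤ q} - α) / p
  have hlp : l * p = μ.real {ξ | X ξ ≤ q} - α := by
    rcases hp0.eq_or_lt with h | h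
    · rw [← h] at hsum ⊢; linarith
    · exact div_mul_cancel₀ _ h.ne'
  have hl0 : 0 ≤ l := div_nonneg (by linarith) hp0
  have hl1 : l ≤ 1 := div_le_one_of_le₀ (by linarith) hp0
  refine ⟨fun x => (Set.Ioi q).indicator (fun _ => 1) x + ({q} : Set ℝ).indicator (fun _ => l) x,
    ?_, ?_, ?_, ?_, ?_⟩
  · exact (measurable_const.indicator measurableSet_Ioi).add
      (measurable_const.indicator (measurableSet_singleton q))
  · intro x
    exact add_nonneg (Set.indicator_nonneg (fun _ _ => zero_le_one) _)
      (Set.indicator_nonneg (fun _ _ => hl0) _)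
  · intro x
    rcases lt_trichotomy x q with h | h | h
    · simp [h.not_gt, h.ne]
    · simp [h, hl1]
    · simp [h, h.ne']
  · intro x
    rcases lt_trichotomy x q with h | h | h
    · simp [h.not_gt, h.ne, h.le]
    · simp [h]
    · simp [h, h.ne', h.le]
  · have hm : MeasurableSet {ξ | q < X ξ} := hX measurableSet_Ioi
    have hgt : μ.real {ξ | q < X ξ} = 1 - μ.real {ξ | X ξ ≤ q} := by
      rw [← probReal_compl_eq_one_sub (measurableSet_le hX measurable_const)]
      congr 1; ext ξ; simp
    have h1 : (fun ξ => (Set.Ioi q).indicator (fun _ => (1 : ℝ)) (X ξ)) =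
        {ξ | q < X ξ}.indicator fun _ => 1 := rfl
    have h2 : (fun ξ => ({q} : Set ℝ).indicator (fun _ => l) (X ξ)) =
        {ξ | X ξ = q}.indicator fun _ => l := rfl
    rw [integral_add (by rw [h1]; exact (integrable_const _).indicator hm)
      (by rw [h2]; exact (integrable_const _).indicator hmeq), h1, h2,
      integral_indicator_const _ hm, integral_indicator_const _ hmeq, hgt]
    simp only [smul_eq_mul, mul_one]
    rw [mul_comm, hlp]; ring

variable {q : ℝ} {z : ℝ → ℝ}

lemma IsTailWeight.integrable (hz : IsTailWeight α q X μ z) (hX : Measurable X) :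
    Integrable (fun ξ => z (X ξ)) μ :=
  Integrable.of_mem_Icc 0 1 (hz.measurable.comp hX).aemeasurable
    (ae_of_all _ fun _ => ⟨hz.nonneg _, hz.le_one _⟩)

lemma integrable_max_sub (hX : Measurable X) (hi : Integrable (fun ξ => max (X ξ) 0) μ) (η : ℝ) :
    Integrable (fun ξ => max (X ξ - η) 0) μ := by
  refine (hi.add (integrable_const |η|)).mono'
    ((hX.sub_const η).max measurable_const).aestronglyMeasurable (ae_of_all _ fun ξ => ?_)
  rw [Real.norm_of_nonneg (le_max_right _ _)]
  have := neg_abs_le η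
  have := abs_nonneg η
  have := le_max_left (X ξ) 0
  have := le_max_right (X ξ) 0
  exact max_le (by simp only [Pi.add_apply]; linarith) (by simp only [Pi.add_apply]; linarith)

/-- Weak duality: the Rockafellar--Uryasev objective of `Y` dominates the linearization at `X` given
by a tail weight of `X`. -/
lemma IsTailWeight.le_objective (hz : IsTailWeight α q X μ z) (hα1 : α < 1) (hX : Measurable X)
    (hi : Integrable (fun ξ => max (X ξ - q) 0) μ)
    (hXY : Integrable (fun ξ => z (X ξ) * (Y ξ - X ξ)) μ) {η : ℝ}
    (hY : Integrable (fun ξ => max (Y ξ - η) 0) μ) :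
    q + 1 / (1 - α) * ∫ ξ, max (X ξ - q) 0 ∂μ + 1 / (1 - α) * ∫ ξ, z (X ξ) * (Y ξ - X ξ) ∂μ ≤
      η + 1 / (1 - α) * ∫ ξ, max (Y ξ - η) 0 ∂μ := by
  have hzi := (hz.integrable hX).mul_const (q - η)
  have h := integral_mono ((hi.add hXY).add hzi) hY fun ξ => hz.le_max (X ξ) (Y ξ) η
  rw [integral_add' (hi.add hXY) hzi, integral_add' hi hXY, integral_mul_const, hz.integral_eq] at h
  have hα' : 0 < 1 - α := by linarith
  have h2 := mul_le_mul_of_nonneg_left h (one_div_nonneg.2 hα'.le)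
  have h3 : 1 / (1 - α) * ((1 - α) * (q - η)) = q - η := by field_simp
  rw [mul_add, mul_add, h3] at h2
  linarith

lemma bddBelow_objective (hα : 0 < α) (hα1 : α < 1) (hX : Measurable X)
    (hi : Integrable (fun ξ => max (X ξ) 0) μ) :
    BddBelow (Set.range fun η : ℝ => η + 1 / (1 - α) * ∫ ξ, max (X ξ - η) 0 ∂μ) := by
  obtain ⟨z, hz⟩ := exists_isTailWeight (μ := μ) hX hα hα1
  refine ⟨VaR α X μ + 1 / (1 - α) * ∫ ξ, max (X ξ - VaR α X μ) 0 ∂μ +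
    1 / (1 - α) * ∫ ξ, z (X ξ) * (X ξ - X ξ) ∂μ, ?_⟩
  rintro _ ⟨η, rfl⟩
  exact hz.le_objective hα1 hX (integrable_max_sub hX hi _) (by simp) (integrable_max_sub hX hi η)

lemma CVaR_le_objective (hα : 0 < α) (hα1 : α < 1) (hX : Measurable X)
    (hi : Integrable (fun ξ => max (X ξ) 0) μ) (η : ℝ) :
    CVaR α X μ ≤ η + 1 / (1 - α) * ∫ ξ, max (X ξ - η) 0 ∂μ :=
  ciInf_le (bddBelow_objective hα hα1 hX hi) η

/-- The value at risk minimizes the Rockafellar--Uryasev objective. -/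
lemma CVaR_eq_objective_VaR (hα : 0 < α) (hα1 : α < 1) (hX : Measurable X)
    (hi : Integrable (fun ξ => max (X ξ) 0) μ) :
    CVaR α X μ = VaR α X μ + 1 / (1 - α) * ∫ ξ, max (X ξ - VaR α X μ) 0 ∂μ := by
  refine (CVaR_le_objective hα hα1 hX hi _).antisymm (le_ciInf fun η => ?_)
  obtain ⟨z, hz⟩ := exists_isTailWeight (μ := μ) hX hα hα1
  have := hz.le_objective hα1 hX (integrable_max_sub hX hi _) (Y := X) (by simp)
    (integrable_max_sub hX hi η)
  simpa using this

lemma VaR_mem_Icc (hα : 0 < α) (hα1 : α < 1) (hX : Measurable X) {a b : ℝ}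
    (h : ∀ᵐ ξ ∂μ, X ξ ∈ Set.Icc a b) : VaR α X μ ∈ Set.Icc a b := by
  constructor
  · refine le_csInf (nonempty_setOf_le_real hX hα1) fun t ht => ?_
    by_contra! hta
    have h0 : μ {ξ | X ξ ≤ t} = 0 :=
      measure_mono_null
      (by intro ξ hξ hx; exact absurd (hx.1.trans hξ) (not_le.2 hta))
      (ae_iff.1 h)
    have : α ≤ μ.real {ξ | X ξ ≤ t} := ht
    rw [measureReal_def, h0, ENNReal.toReal_zero] at this
    linarith
  · refine VaR_le_of_le_real hX hα ?_
    have h1 : μ {ξ | X ξ ≤ b} = 1 := 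
      (ae_iff_prob_eq_one (measurableSet_setOfPred.1 (measurableSet_le hX measurable_const))).1
        (h.mono fun ξ hξ => hξ.2)
    rw [measureReal_def, h1, ENNReal.toReal_one]
    exact hα1.le

end Quantile

/-! ### The empirical quantile as a value at risk -/

section Empirical

variable {B : ℕ} {α : ℝ}

lemma uniformOn_univ_real [NeZero B] (s : Finset (Fin B)) :
    (uniformOn (Set.univ : Set (Fin B))).real s = s.card / B := by
  rw [measureReal_def, uniformOn_univ, Measure.count_apply_finset]
  simp

lemma integral_uniformOn_univ [NeZero B] (f : Fin B → ℝ) :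
    ∫ i, f i ∂(uniformOn (Set.univ : Set (Fin B))) = 1 / B * ∑ i, f i := by
  have : IsProbabilityMeasure (uniformOn (Set.univ : Set (Fin B))) :=
    isProbabilityMeasure_uniformOn Set.finite_univ Set.univ_nonempty
  rw [integral_fintype .of_finite, Finset.mul_sum]
  refine Finset.sum_congr rfl fun i _ => ?_
  have := uniformOn_univ_real ({i} : Finset (Fin B))
  simp only [Finset.coe_singleton, Finset.card_singleton, Nat.cast_one] at this
  rw [this, smul_eq_mul]

lemma uniformOn_univ_real_setOf [NeZero B] (p : Fin B → Prop) [DecidablePred p] :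
    (uniformOn (Set.univ : Set (Fin B))).real {i | p i} = (Finset.univ.filter p).card / B := by
  rw [← uniformOn_univ_real]; congr 1; ext; simp

/-- The empirical quantile is the value at risk under the uniform measure on the sample. -/
lemma empQuantile_eq_VaR [NeZero B] (x : Fin B → ℝ) :
    empQuantile α x = VaR α x (uniformOn Set.univ) := by
  simp only [empQuantile, VaR, uniformOn_univ_real_setOf]

lemma empCVaR_le_objective (hα : 0 < α) (hα1 : α < 1) (hB : 0 < B) (x : Fin B → ℝ) (η : ℝ) :
    empCVaR α x ≤ η + 1 / ((1 - α) * B) * ∑ i, max (x i - η) 0 := by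
  have : NeZero B := ⟨hB.ne'⟩
  have : IsProbabilityMeasure (uniformOn (Set.univ : Set (Fin B))) :=
    isProbabilityMeasure_uniformOn Set.finite_univ Set.univ_nonempty
  have hx : Measurable x := .of_discrete
  have h1 := CVaR_eq_objective_VaR (μ := uniformOn Set.univ) hα hα1 hx .of_finite
  have h2 := CVaR_le_objective (μ := uniformOn Set.univ) hα hα1 hx .of_finite η
  rw [h1, ← empQuantile_eq_VaR, integral_uniformOn_univ, integral_uniformOn_univ,
    ← mul_assoc, ← mul_assoc, one_div_mul_one_div] at h2
  exact h2

lemma empQuantile_mem_Icc (hα : 0 < α) (hα1 : α < 1) (hB : 0 < B) {x : Fin B → ℝ} {a b : ℝ}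
    (h : ∀ i, x i ∈ Set.Icc a b) :
    empQuantile α x ∈ Set.Icc a b := by
  have : NeZero B := ⟨hB.ne'⟩
  have : IsProbabilityMeasure (uniformOn (Set.univ : Set (Fin B))) :=
    isProbabilityMeasure_uniformOn Set.finite_univ Set.univ_nonempty
  rw [empQuantile_eq_VaR]
  exact VaR_mem_Icc hα hα1 .of_discrete (ae_of_all _ h)

lemma le_card_le_empQuantile (hα1 : α < 1) (hB : 0 < B) (x : Fin B → ℝ) :
    α * B ≤ (Finset.univ.filter fun i => x i ≤ empQuantile α x).card := by
  have : NeZero B := ⟨hB.ne'⟩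
  have : IsProbabilityMeasure (uniformOn (Set.univ : Set (Fin B))) :=
    isProbabilityMeasure_uniformOn Set.finite_univ Set.univ_nonempty
  have h := le_real_le_VaR (μ := uniformOn Set.univ) (X := x) .of_discrete hα1
  rwa [← empQuantile_eq_VaR, uniformOn_univ_real_setOf, le_div_iff₀ (by positivity)] at h

lemma card_lt_empQuantile_le (hα : 0 < α) (hB : 0 < B) (x : Fin B → ℝ) :
    ((Finset.univ.filter fun i => x i < empQuantile α x).card : ℝ) ≤ α * B := by
  have : NeZero B := ⟨hB.ne'⟩
  have : IsProbabilityMeasure (uniformOn (Set.univ : Set (Fin B))) :=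
    isProbabilityMeasure_uniformOn Set.finite_univ Set.univ_nonempty
  have h := real_lt_VaR_le (μ := uniformOn Set.univ) (X := x) .of_discrete hα
  rwa [← empQuantile_eq_VaR, uniformOn_univ_real_setOf, div_le_iff₀ (by positivity)] at h

end Empirical

/-! ### Gradients of squeezed functions and of integrals -/

section Gradient

variable {E : Type*} [NormedAddCommGroup E] [InnerProductSpace ℝ E] [CompleteSpace E]
  {Ξ : Type*} [MeasurableSpace Ξ] {μ : Measure Ξ}

/-- A function squeezed between two functions that touch it at `x` and have the same gradient there
has that gradient at `x`. -/
lemma HasGradientAt.of_le_of_le {f l u : E → ℝ} {g x : E} (hl : HasGradientAt l g x)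
    (hu : HasGradientAt u g x) (hlf : ∀ᶠ y in 𝓝 x, l y ≤ f y) (hfu : ∀ᶠ y in 𝓝 x, f y ≤ u y)
    (hlx : l x = f x) (hux : u x = f x) : HasGradientAt f g x := by
  rw [hasGradientAt_iff_hasFDerivAt, hasFDerivAt_iff_isLittleO] at *
  refine Asymptotics.IsBigO.trans_isLittleO (.of_bound' ?_) (hl.norm_left.add hu.norm_left)
  filter_upwards [hlf, hfu] with y h1 h2
  rw [hlx, hux]
  simp only [Real.norm_eq_abs]
  refine le_trans ?_ (le_abs_self _)
  refine abs_le.2 ⟨?_, ?_⟩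
  · linarith [neg_abs_le (l y - f x - InnerProductSpace.toDual ℝ E g (y - x)),
      abs_nonneg (u y - f x - InnerProductSpace.toDual ℝ E g (y - x))]
  · linarith [le_abs_self (u y - f x - InnerProductSpace.toDual ℝ E g (y - x)),
      abs_nonneg (l y - f x - InnerProductSpace.toDual ℝ E g (y - x))]

lemma hasGradientAt_integral_of_dominated_loc_of_lip [IsFiniteMeasure μ] {F : E → Ξ → ℝ} {g : Ξ → E}
    {x₀ : E} {s : Set E} {G : ℝ} (hs : s ∈ 𝓝 x₀)
    (hF_meas : ∀ x ∈ s, AEStronglyMeasurable (F x) μ) (hF_int : Integrable (F x₀) μ)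
    (hg : AEStronglyMeasurable g μ)
    (h_lip : ∀ᵐ ξ ∂μ, ∀ x ∈ s, |F x ξ - F x₀ ξ| ≤ G * ‖x - x₀‖)
    (h_diff : ∀ᵐ ξ ∂μ, HasGradientAt (fun x => F x ξ) (g ξ) x₀) :
    Integrable g μ ∧ HasGradientAt (fun x => ∫ ξ, F x ξ ∂μ) (∫ ξ, g ξ ∂μ) x₀ := by
  have hcont : AEStronglyMeasurable (fun ξ => InnerProductSpace.toDual ℝ E (g ξ)) μ :=
    (InnerProductSpace.toDual ℝ E).continuous.comp_aestronglyMeasurable hg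
  obtain ⟨hi, hd⟩ := hasFDerivAt_integral_of_dominated_loc_of_lip' (𝕜 := ℝ) hs hF_meas hF_int hcont
    h_lip (integrable_const G) (h_diff.mono fun ξ h => h.hasFDerivAt)
  have hgi : Integrable g μ := by
    refine hi.norm.mono' hg (ae_of_all _ fun ξ => ?_)
    simp
  refine ⟨hgi, ?_⟩
  rw [hasGradientAt_iff_hasFDerivAt]
  suffices heq : InnerProductSpace.toDual ℝ E (∫ ξ, g ξ ∂μ) =
      ∫ ξ, InnerProductSpace.toDual ℝ E (g ξ) ∂μ by rwa [heq]
  ext v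
  rw [ContinuousLinearMap.integral_apply hi, InnerProductSpace.toDual_apply_apply, real_inner_comm,
    ← integral_inner hgi]
  simp only [InnerProductSpace.toDual_apply_apply, real_inner_comm]

lemma Convex.abs_sub_le_of_norm_gradient_le {f : E → ℝ} {s : Set E} (hs : Convex ℝ s) {G : ℝ}
    (hd : ∀ x ∈ s, DifferentiableAt ℝ f x) (hG : ∀ x ∈ s, ‖gradient f x‖ ≤ G) {x y : E}
    (hx : x ∈ s) (hy : y ∈ s) : |f y - f x| ≤ G * ‖y - x‖ := by
  refine hs.norm_image_sub_le_of_norm_fderiv_le (𝕜 := ℝ) hd (fun z hz => ?_) hx hy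
  rw [← toDual_gradient, LinearIsometryEquiv.norm_map]
  exact hG z hz

/-- The gradient of a random function at a point is measurable, as the limit of the difference
quotients along an orthonormal basis. -/
lemma aestronglyMeasurable_gradient [FiniteDimensional ℝ E] {J : E → Ξ → ℝ} {Θ : Set E} {θ : E}
    (hΘ : Θ ∈ 𝓝 θ) (hJ : ∀ τ ∈ Θ, AEStronglyMeasurable (J τ) μ)
    (hd : ∀ᵐ ξ ∂μ, DifferentiableAt ℝ (fun τ => J τ ξ) θ) :
    AEStronglyMeasurable (fun ξ => gradient (fun τ => J τ ξ) θ) μ := by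
  let b := stdOrthonormalBasis ℝ E
  have hlim : ∀ v : E, AEStronglyMeasurable (fun ξ => fderiv ℝ (fun τ => J τ ξ) θ v) μ := by
    intro v
    have ht : Tendsto (fun n : ℕ => θ + (n : ℝ)⁻¹ • v) atTop (𝓝 θ) := by
      have := (tendsto_inv_atTop_nhds_zero_nat (𝕜 := ℝ)).smul_const v
      simpa using this.const_add θ
    obtain ⟨N, hN⟩ := eventually_atTop.1 (ht.eventually hΘ)
    refine aestronglyMeasurable_of_tendsto_ae atTop
      (f := fun (n : ℕ) ξ => ((n + N : ℕ) : ℝ) • (J (θ + ((n + N : ℕ) : ℝ)⁻¹ • v) ξ - J θ ξ))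
      (fun n => ((hJ _ (hN (n + N) (by omega))).sub (hJ _ (mem_of_mem_nhds hΘ))).const_smul
        ((n + N : ℕ) : ℝ)) ?_
    filter_upwards [hd] with ξ hξ
    refine (tendsto_add_atTop_iff_nat (f := fun n : ℕ =>
      (n : ℝ) • (J (θ + (n : ℝ)⁻¹ • v) ξ - J θ ξ)) N).2 ?_
    exact (hξ.hasFDerivAt.lim_real v).comp tendsto_natCast_atTop_atTop
  have hb : ∀ ξ, gradient (fun τ => J τ ξ) θ = ∑ k, fderiv ℝ (fun τ => J τ ξ) θ (b k) • b k := by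
    intro ξ
    conv_lhs => rw [← b.sum_repr' (gradient (fun τ => J τ ξ) θ)]
    refine Finset.sum_congr rfl fun k _ => ?_
    rw [← toDual_gradient, InnerProductSpace.toDual_apply_apply, real_inner_comm]
  simp only [hb]
  exact Finset.aestronglyMeasurable_fun_sum _ fun k _ => (hlim (b k)).smul_const (b k)

lemma HasGradientAt.max_sub_zero {f : E → ℝ} {g x : E} {q : ℝ} (hf : HasGradientAt f g x)
    (hq : f x ≠ q) :
    HasGradientAt (fun y => max (f y - q) 0) (if q ≤ f x then g else 0) x := by
  have hc := hf.differentiableAt.continuousAt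
  rcases lt_or_gt_of_ne hq with h | h
  · rw [if_neg h.not_ge]
    refine (hasGradientAt_const x (0 : ℝ)).congr_of_eventuallyEq ?_
    filter_upwards [hc.eventually (gt_mem_nhds h)] with y hy
    exact max_eq_right (by linarith)
  · rw [if_pos h.le]
    refine HasGradientAt.congr_of_eventuallyEq (f := fun y => f y - q) ?_ ?_
    · exact hasGradientAt_iff_hasFDerivAt.2 (hf.hasFDerivAt.sub_const q)
    filter_upwards [hc.eventually (lt_mem_nhds h)] with y hy
    exact max_eq_left (by linarith)

end Gradient

/-! ### The gradient of the conditional value at risk -/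

section CVaRGradient

variable {E : Type*} [NormedAddCommGroup E] [InnerProductSpace ℝ E] [FiniteDimensional ℝ E]
  {Ξ : Type*} [MeasurableSpace Ξ] {μ : Measure Ξ} [IsProbabilityMeasure μ]

/-- Danskin's formula for `CVaR`. The upper function in the squeeze freezes the quantile at its
optimal value, the lower one freezes the tail weight. -/
theorem hasGradientAt_CVaR {J : E → Ξ → ℝ} {Θ : Set E} {θ : E} {α G : ℝ} (hΘ : IsOpen Θ)
    (hθ : θ ∈ Θ) (hα : 0 < α) (hα1 : α < 1) (hJ : ∀ τ ∈ Θ, Measurable (J τ))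
    (hi : Integrable (fun ξ => max (J θ ξ) 0) μ)
    (hd : ∀ᵐ ξ ∂μ, ∀ τ ∈ Θ, DifferentiableAt ℝ (fun τ' => J τ' ξ) τ)
    (hG : ∀ᵐ ξ ∂μ, ∀ τ ∈ Θ, ‖gradient (fun τ' => J τ' ξ) τ‖ ≤ G)
    (hq : μ {ξ | J θ ξ = VaR α (J θ) μ} = 0) :
    Integrable ({ξ | VaR α (J θ) μ ≤ J θ ξ}.indicator fun ξ => gradient (fun τ => J τ ξ) θ) μ ∧
      HasGradientAt (fun τ => CVaR α (J τ) μ)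
        ((1 / (1 - α)) • ∫ ξ, {ξ | VaR α (J θ) μ ≤ J θ ξ}.indicator
          (fun ξ => gradient (fun τ => J τ ξ) θ) ξ ∂μ) θ := by
  set q := VaR α (J θ) μ with hqdef
  set g : Ξ → E := {ξ | q ≤ J θ ξ}.indicator fun ξ => gradient (fun τ => J τ ξ) θ with hg
  have hm : MeasurableSet {ξ | q ≤ J θ ξ} := measurableSet_le measurable_const (hJ θ hθ)
  have hgm : AEStronglyMeasurable g μ :=
    (aestronglyMeasurable_gradient (hΘ.mem_nhds hθ) (fun τ hτ => (hJ τ hτ).aestronglyMeasurable)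
      (hd.mono fun ξ h => h θ hθ)).indicator hm
  obtain ⟨r, hr, hrΘ⟩ := Metric.isOpen_iff.1 hΘ θ hθ
  have hθr : θ ∈ Metric.ball θ r := Metric.mem_ball_self hr
  have hs : Metric.ball θ r ∈ 𝓝 θ := Metric.ball_mem_nhds θ hr
  have hlip : ∀ᵐ ξ ∂μ, ∀ τ ∈ Metric.ball θ r, |J τ ξ - J θ ξ| ≤ G * ‖τ - θ‖ := by
    filter_upwards [hd, hG] with ξ h1 h2 τ hτ
    exact (convex_ball θ r).abs_sub_le_of_norm_gradient_le (fun x hx => h1 x (hrΘ hx))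
      (fun x hx => h2 x (hrΘ hx)) hθr hτ
  have hne : ∀ᵐ ξ ∂μ, J θ ξ ≠ q := by rw [ae_iff]; simpa using hq
  obtain ⟨z, hz⟩ := exists_isTailWeight (μ := μ) (hJ θ hθ) hα hα1
  -- without an atom at the quantile the tail weight is the indicator of the tail
  have hgz : ∀ᵐ ξ ∂μ, g ξ = z (J θ ξ) • gradient (fun τ => J τ ξ) θ := by
    filter_upwards [hne] with ξ h
    rcases lt_or_gt_of_ne h with h | h
    · rw [hz.eq_zero h, zero_smul, hg, Set.indicator_of_notMem (by simpa using h)]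
    · rw [hz.eq_one h, one_smul, hg, Set.indicator_of_mem (by simpa using h.le)]
  have hint_diff : ∀ τ ∈ Metric.ball θ r, Integrable (fun ξ => J τ ξ - J θ ξ) μ := fun τ hτ =>
    (integrable_const (G * ‖τ - θ‖)).mono'
      ((hJ τ (hrΘ hτ)).sub (hJ θ hθ)).aestronglyMeasurable (hlip.mono fun ξ h => h τ hτ)
  have hint : ∀ τ ∈ Metric.ball θ r, Integrable (fun ξ => max (J τ ξ) 0) μ := fun τ hτ => by
    refine (hi.add (hint_diff τ hτ).norm).mono'
      ((hJ τ (hrΘ hτ)).max measurable_const).aestronglyMeasurable (ae_of_all _ fun ξ => ?_)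
    rw [Real.norm_of_nonneg (le_max_right _ _)]
    have h1 := le_abs_self (J τ ξ - J θ ξ)
    have h2 := le_max_left (J θ ξ) 0
    simp only [Pi.add_apply, Real.norm_eq_abs]
    exact max_le (by linarith) (add_nonneg (le_max_right _ _) (abs_nonneg _))
  have hiq := integrable_max_sub (hJ θ hθ) hi q
  have hval := CVaR_eq_objective_VaR hα hα1 (hJ θ hθ) hi
  rw [← hqdef] at hval
  obtain ⟨hgi, hu⟩ := hasGradientAt_integral_of_dominated_loc_of_lip
    (F := fun τ ξ => max (J τ ξ - q) 0) (g := g) (G := G) hs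
    (fun τ hτ => (((hJ τ (hrΘ hτ)).sub_const q).max measurable_const).aestronglyMeasurable)
    hiq hgm
    (by
      filter_upwards [hlip] with ξ h τ hτ
      have := abs_max_sub_max_le_abs (J τ ξ - q) (J θ ξ - q) 0
      rw [sub_sub_sub_cancel_right] at this
      exact this.trans (h τ hτ))
    (by
      filter_upwards [hd, hne] with ξ h h'
      exact (h θ hθ).hasGradientAt.max_sub_zero h')
  obtain ⟨-, hl⟩ := hasGradientAt_integral_of_dominated_loc_of_lip
    (F := fun τ ξ => z (J θ ξ) * (J τ ξ - J θ ξ)) (g := g) (G := G) hs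
    (fun τ hτ => ((hz.measurable.comp (hJ θ hθ)).mul
      ((hJ τ (hrΘ hτ)).sub (hJ θ hθ))).aestronglyMeasurable)
    (by simp) hgm
    (by
      filter_upwards [hlip] with ξ h τ hτ
      rw [sub_self, mul_zero, sub_zero, abs_mul, abs_of_nonneg (hz.nonneg _)]
      exact (mul_le_of_le_one_left (abs_nonneg _) (hz.le_one _)).trans (h τ hτ))
    (by
      filter_upwards [hd, hgz] with ξ h h'
      rw [h', hasGradientAt_iff_hasFDerivAt, map_smul]
      exact ((h θ hθ).hasGradientAt.hasFDerivAt.sub_const _).const_mul _)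
  refine ⟨hgi, ?_⟩
  have key : ∀ {f : E → ℝ} {v : E} (c : ℝ), HasGradientAt f v θ →
      HasGradientAt (fun τ => c + 1 / (1 - α) * f τ) ((1 / (1 - α)) • v) θ := by
    intro f v c h
    rw [hasGradientAt_iff_hasFDerivAt] at h ⊢
    rw [map_smul]
    exact (h.const_mul _).const_add c
  refine HasGradientAt.of_le_of_le
    (key (q + 1 / (1 - α) * ∫ ξ, max (J θ ξ - q) 0 ∂μ) hl) (key q hu) ?_ ?_ ?_ ?_
  · filter_upwards [hs] with τ hτ
    refine le_ciInf fun η => hz.le_objective hα1 (hJ θ hθ) hiq ?_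
      (integrable_max_sub (hJ τ (hrΘ hτ)) (hint τ hτ) η)
    exact (hint_diff τ hτ).bdd_mul (c := 1) (hz.measurable.comp (hJ θ hθ)).aestronglyMeasurable
      (ae_of_all _ fun ξ => by
        rw [Real.norm_of_nonneg (hz.nonneg _)]; exact hz.le_one _)
  · filter_upwards [hs] with τ hτ
    exact CVaR_le_objective hα hα1 (hJ τ (hrΘ hτ)) (hint τ hτ) q
  · simp [hval]
  · simp [hval]

end CVaRGradient

/-! ### Hoeffding bounds for sample means -/

section Hoeffding

variable {Ξ Ω : Type*} [MeasurableSpace Ξ] [MeasurableSpace Ω] {μ : Measure Ξ} {P : Measure Ω}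
  [IsProbabilityMeasure P] {B : ℕ} {ξ : Fin B → Ω → Ξ}

lemma measureReal_mean_sub_gt_le (hB : 0 < B) (hξ : ∀ i, HasLaw (ξ i) μ P) (hind : iIndepFun ξ P)
    {h : Ξ → ℝ} (hm : AEMeasurable h μ) {a b : ℝ} (hab : ∀ᵐ x ∂μ, h x ∈ Set.Icc a b) {s : ℝ}
    (hs : 0 ≤ s) :
    P.real {ω | (b - a) * s < 1 / B * ∑ i, h (ξ i ω) - ∫ x, h x ∂μ} ≤
      Real.exp (-2 * B * s ^ 2) := by
  have : IsProbabilityMeasure μ := (hξ ⟨0, hB⟩).isProbabilityMeasure_iff.1 inferInstance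
  obtain ⟨x, hx⟩ := hab.exists
  have hB' : (0 : ℝ) < B := by exact_mod_cast hB
  have hmi : ∀ i, AEMeasurable h (P.map (ξ i)) := fun i => by rwa [(hξ i).map_eq]
  have hba : ∀ i, ∀ᵐ ω ∂P, h (ξ i ω) ∈ Set.Icc a b := fun i =>
    ae_of_ae_map (hξ i).aemeasurable (by rwa [(hξ i).map_eq])
  rcases (hx.1.trans hx.2).eq_or_lt with hab' | hab'
  · -- a degenerate range makes `h` a.e. constant, so the sample mean has no deviation
    subst hab'
    have h0 : ∀ᵐ ω ∂P, ¬ (a - a) * s < 1 / B * ∑ i, h (ξ i ω) - ∫ x, h x ∂μ := by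
      filter_upwards [ae_all_iff.2 hba] with ω hω
      have hint : ∫ x, h x ∂μ = a := by
        rw [integral_congr_ae (g := fun _ => a) (hab.mono fun x hx => le_antisymm hx.2 hx.1)]
        simp
      rw [hint, Finset.sum_congr rfl fun i _ => le_antisymm (hω i).2 (hω i).1]
      simp [hB'.ne']
    rw [measureReal_def, show P {ω | (a - a) * s < 1 / B * ∑ i, h (ξ i ω) - ∫ x, h x ∂μ} = 0 by
      simpa [ae_iff] using h0, ENNReal.toReal_zero]
    positivity
  set Y : Fin B → Ω → ℝ := fun i ω => h (ξ i ω) - ∫ x, h x ∂μ with hY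
  have hYind : iIndepFun Y P :=
    hind.comp₀ (fun _ x => h x - ∫ x, h x ∂μ) (fun i => (hξ i).aemeasurable)
      fun i => (hmi i).sub_const _
  have hsub : ∀ i ∈ (Finset.univ : Finset (Fin B)),
      HasSubgaussianMGF (Y i) ((‖b - a‖₊ / 2) ^ 2) P := fun i _ => by
    have := hasSubgaussianMGF_of_mem_Icc ((hmi i).comp_aemeasurable (hξ i).aemeasurable) (hba i)
    rwa [(hξ i).integral_comp hm.aestronglyMeasurable] at this
  have hε : 0 ≤ B * ((b - a) * s) := mul_nonneg hB'.le (mul_nonneg (by linarith) hs)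
  refine le_trans (measureReal_mono fun ω hω => ?_)
    ((HasSubgaussianMGF.measure_sum_ge_le_of_iIndepFun hYind hsub hε).trans_eq ?_)
  · have hω' : (b - a) * s < 1 / B * ∑ i, h (ξ i ω) - ∫ x, h x ∂μ := hω
    have h1 := mul_lt_mul_of_pos_left hω' hB'
    rw [mul_sub, ← mul_assoc _ (1 / (B : ℝ)), mul_one_div_cancel hB'.ne', one_mul] at h1
    simpa [hY, Finset.sum_sub_distrib] using h1.le
  · congr 1
    have hne : b - a ≠ 0 := by linarith
    simp only [Finset.sum_const, Finset.card_univ, Fintype.card_fin, nsmul_eq_mul, NNReal.coe_mul,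
      NNReal.coe_natCast, NNReal.coe_pow, NNReal.coe_div, coe_nnnorm, NNReal.coe_ofNat,
      Real.norm_eq_abs, div_pow, sq_abs]
    field_simp

/-- **Hoeffding's inequality** for the mean of a bounded function along an i.i.d. sample, including
the degenerate range `a = b`. -/
lemma measureReal_abs_mean_sub_gt_le (hB : 0 < B) (hξ : ∀ i, HasLaw (ξ i) μ P)
    (hind : iIndepFun ξ P) {h : Ξ → ℝ} (hm : AEMeasurable h μ) {a b : ℝ}
    (hab : ∀ᵐ x ∂μ, h x ∈ Set.Icc a b) {s : ℝ} (hs : 0 ≤ s) :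
    P.real {ω | (b - a) * s < |1 / B * ∑ i, h (ξ i ω) - ∫ x, h x ∂μ|} ≤
      2 * Real.exp (-2 * B * s ^ 2) := by
  have h1 := measureReal_mean_sub_gt_le hB hξ hind hm hab hs
  have h2 := measureReal_mean_sub_gt_le hB hξ hind hm.neg (a := -b) (b := -a)
    (hab.mono fun x hx => ⟨neg_le_neg hx.2, neg_le_neg hx.1⟩) hs
  rw [two_mul]
  refine le_trans (measureReal_mono ?_) ((measureReal_union_le _ _).trans (add_le_add h1 h2))
  intro ω hω
  have hω' : (b - a) * s < |1 / B * ∑ i, h (ξ i ω) - ∫ x, h x ∂μ| := hω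
  rcases lt_abs.1 hω' with h | h
  · exact .inl h
  · refine .inr ?_
    simp only [Set.mem_ofPred_eq, Pi.neg_apply, Finset.sum_neg_distrib, integral_neg]
    linarith

end Hoeffding

/-! ### Concentration of the empirical conditional value at risk -/

section Value

variable {Ξ Ω : Type*} [MeasurableSpace Ξ] [MeasurableSpace Ω] {μ : Measure Ξ} {P : Measure Ω}
  {X : Ξ → ℝ} {α : ℝ} {B : ℕ}

/-- The error of the empirical CVaR is controlled by two sample means at the true quantile `q`: that
of the hinge `(X - q)₊` and that of the tail weight. No uniformity over thresholds is needed, since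
a wrong slope `1 - α` of the empirical objective at `q` costs at most the range of the sample. -/
lemma abs_empCVaR_sub_le (hα : 0 < α) (hα1 : α < 1) (hB : 0 < B) {q J e s : ℝ} {z : ℝ → ℝ}
    (hz : IsTailWeight α q X μ z) {x : Fin B → ℝ} (hx : ∀ i, x i ∈ Set.Icc 0 J)
    (hq : q ∈ Set.Icc 0 J) (h1 : |1 / B * ∑ i, max (x i - q) 0 - e| ≤ J * s)
    (h2 : |1 / B * ∑ i, z (x i) - (1 - α)| ≤ s) :
    |empCVaR α x - (q + 1 / (1 - α) * e)| ≤ 2 * (J / (1 - α) * s) := by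
  have hB' : (0 : ℝ) < B := by exact_mod_cast hB
  have hα' : 0 < 1 - α := by linarith
  have hJ : 0 ≤ J := hq.1.trans hq.2
  set m := 1 / B * ∑ i, max (x i - q) 0 with hm
  set w := 1 / B * ∑ i, z (x i) with hw
  set η := empQuantile α x with hη
  have hηJ : η ∈ Set.Icc 0 J := empQuantile_mem_Icc hα hα1 hB hx
  have hup : empCVaR α x ≤ q + 1 / (1 - α) * m := by
    have := empCVaR_le_objective hα hα1 hB x q
    rwa [← one_div_mul_one_div, mul_assoc] at this
  have hlow : η + 1 / (1 - α) * (m + w * (q - η)) ≤ empCVaR α x := by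
    rw [empCVaR, ← one_div_mul_one_div, mul_assoc (1 / (1 - α)) (1 / (B : ℝ))]
    have h : m + w * (q - η) ≤ 1 / B * ∑ i, max (x i - η) 0 := by
      rw [hm, hw, mul_assoc, ← mul_add, Finset.sum_mul, ← Finset.sum_add_distrib]
      refine mul_le_mul_of_nonneg_left (Finset.sum_le_sum fun i _ => ?_) (by positivity)
      simpa using hz.le_max (x i) (x i) η
    gcongr
  have hs : 0 ≤ s := (abs_nonneg _).trans h2
  have habs : |(η - q) * (w - (1 - α))| ≤ J * s := by
    rw [abs_mul]
    refine mul_le_mul (abs_le.2 ⟨?_, ?_⟩) h2 (abs_nonneg _) hJ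
    · linarith [hηJ.1, hq.2]
    · linarith [hηJ.2, hq.1]
  have e1 : η + 1 / (1 - α) * (m + w * (q - η)) =
      q + 1 / (1 - α) * (m - (η - q) * (w - (1 - α))) := by
    field_simp
    ring
  rw [e1] at hlow
  have hrhs : 2 * (J / (1 - α) * s) = 1 / (1 - α) * (2 * (J * s)) := by ring
  have hc : 0 ≤ 1 / (1 - α) := by positivity
  have h1' := abs_le.1 h1
  have h2' := abs_le.1 habs
  have hJs := mul_nonneg hJ hs
  rw [hrhs, abs_le]
  constructor
  · have := mul_le_mul_of_nonneg_left
      (show e - 2 * (J * s) ≤ m - (η - q) * (w - (1 - α)) by linarith) hc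
    linarith
  · have := mul_le_mul_of_nonneg_left (show m ≤ e + 2 * (J * s) by linarith) hc
    linarith

/-- Concentration of the empirical CVaR at an arbitrary deviation level `s`. -/
lemma measureReal_abs_empCVaR_sub_gt_le [IsProbabilityMeasure μ] [IsProbabilityMeasure P]
    (hα : 0 < α) (hα1 : α < 1) (hX : Measurable X) {J : ℝ} (hXJ : ∀ᵐ x ∂μ, X x ∈ Set.Icc 0 J)
    {ξ : Fin B → Ω → Ξ} (hB : 0 < B) (hξ : ∀ i, HasLaw (ξ i) μ P) (hind : iIndepFun ξ P) {s : ℝ}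
    (hs : 0 ≤ s) :
    P.real {ω | 2 * (J / (1 - α) * s) < |empCVaR α (fun i => X (ξ i ω)) - CVaR α X μ|} ≤
      4 * Real.exp (-2 * B * s ^ 2) := by
  obtain ⟨z, hz⟩ := exists_isTailWeight (μ := μ) hX hα hα1
  set q := VaR α X μ with hqdef
  have hq : q ∈ Set.Icc 0 J := VaR_mem_Icc hα hα1 hX hXJ
  have hi : Integrable (fun ξ => max (X ξ) 0) μ :=
    Integrable.of_mem_Icc 0 J (hX.max measurable_const).aemeasurable
      (hXJ.mono fun x hx => ⟨le_max_right _ _, max_le hx.2 (hx.1.trans hx.2)⟩)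
  have hp1 := measureReal_abs_mean_sub_gt_le hB hξ hind (h := fun x => max (X x - q) 0)
    ((hX.sub_const q).max measurable_const).aemeasurable (a := 0) (b := J)
    (hXJ.mono fun x hx => ⟨le_max_right _ _, max_le (by linarith [hx.2, hq.1])
      (hx.1.trans hx.2)⟩) hs
  have hp2 := measureReal_abs_mean_sub_gt_le hB hξ hind (h := fun x => z (X x))
    (hz.measurable.comp hX).aemeasurable (a := 0) (b := 1)
    (ae_of_all _ fun x => ⟨hz.nonneg _, hz.le_one _⟩) hs
  have hp3 : P.real {ω | ¬ ∀ i, X (ξ i ω) ∈ Set.Icc 0 J} = 0 := by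
    rw [measureReal_def, ENNReal.toReal_eq_zero_iff]
    exact .inl <| ae_iff.1 <| ae_all_iff.2 fun i =>
      ae_of_ae_map (hξ i).aemeasurable (by rwa [(hξ i).map_eq])
  rw [hz.integral_eq] at hp2
  rw [CVaR_eq_objective_VaR hα hα1 hX hi, ← hqdef]
  calc _ ≤ P.real (({ω | (J - 0) * s < |1 / B * ∑ i, max (X (ξ i ω) - q) 0 -
              ∫ x, max (X x - q) 0 ∂μ|} ∪
            {ω | (1 - 0) * s < |1 / B * ∑ i, z (X (ξ i ω)) - (1 - α)|}) ∪
            {ω | ¬ ∀ i, X (ξ i ω) ∈ Set.Icc 0 J}) := by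
        refine measureReal_mono fun ω hω => ?_
        by_contra hcon
        simp only [Set.mem_union, Set.mem_ofPred_eq, not_or, not_lt, not_not, sub_zero, one_mul]
          at hcon hω
        exact absurd (abs_empCVaR_sub_le hα hα1 hB hz hcon.2 hq hcon.1.1 hcon.1.2) (not_le.2 hω)
    _ ≤ (2 * Real.exp (-2 * B * s ^ 2) + 2 * Real.exp (-2 * B * s ^ 2)) + 0 :=
        (measureReal_union_le _ _).trans
          (add_le_add ((measureReal_union_le _ _).trans (add_le_add hp1 hp2)) hp3.le)
    _ = _ := by ring

/-- The constant depends on `δ₀` alone: it absorbs the prefactor `4` of the union bound, using that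
`log (1 / δ)` stays above `log (1 / δ₀) > 0`. -/
theorem exists_empCVaR_concentration_const {δ₀ : ℝ} (hδ₀ : 0 < δ₀) (hδ₀1 : δ₀ < 1) :
    ∃ C : ℝ, 0 < C ∧
      ∀ (Ξ : Type*) [MeasurableSpace Ξ] (μ : Measure Ξ) [IsProbabilityMeasure μ]
        (X : Ξ → ℝ) (α Jmax : ℝ), 0 < α → α < 1 → Measurable X →
        (∀ᵐ ξ ∂μ, X ξ ∈ Set.Icc 0 Jmax) →
        ∀ (Ω : Type*) [MeasurableSpace Ω] (P : Measure Ω) [IsProbabilityMeasure P]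
          (B : ℕ) (ξ : Fin B → Ω → Ξ), 0 < B → (∀ i, HasLaw (ξ i) μ P) → iIndepFun ξ P →
          ∀ δ : ℝ, 0 < δ → δ ≤ δ₀ →
            1 - δ ≤ P.real {ω | |empCVaR α (fun i => X (ξ i ω)) - CVaR α X μ| ≤
              C * (Jmax / (1 - α) * √(Real.log (1 / δ) / B))} := by
  have hL0 : 0 < Real.log (1 / δ₀) := Real.log_pos (one_lt_one_div hδ₀ hδ₀1)
  set L0 := Real.log (1 / δ₀)
  set K := 1 + 2 / L0 with hK
  have hK1 : 1 ≤ K := le_add_of_nonneg_right (by positivity)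
  refine ⟨2 * K, by positivity, ?_⟩
  intro Ξ _ μ _ X α Jmax hα hα1 hX hXJ Ω _ P _ B ξ hB hξ hind δ hδ hδδ₀
  set L := Real.log (1 / δ)
  have hB' : (0 : ℝ) < B := by exact_mod_cast hB
  have hL : L0 ≤ L := Real.log_le_log (by positivity) (one_div_le_one_div_of_le hδ hδδ₀)
  have hLpos : 0 < L := hL0.trans_le hL
  have key := measureReal_abs_empCVaR_sub_gt_le hα hα1 hX hXJ hB hξ hind (s := K * √(L / B))
    (by positivity)
  have hexp : 4 * Real.exp (-2 * B * (K * √(L / B)) ^ 2) ≤ δ := by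
    have e1 : -2 * B * (K * √(L / B)) ^ 2 = -2 * K ^ 2 * L := by
      rw [mul_pow, Real.sq_sqrt (by positivity)]; field_simp
    have e2 : δ = Real.exp (-L) := by
      rw [← Real.log_inv, one_div, inv_inv, Real.exp_log hδ]
    have e3 : 4 + L ≤ 2 * K ^ 2 * L := by
      have h1 : 2 * K * L ≤ 2 * K ^ 2 * L := by
        have : K ≤ K ^ 2 := le_self_pow₀ hK1 two_ne_zero
        gcongr
      have h2 : 1 ≤ L / L0 := (one_le_div hL0).2 hL
      have h3 : 2 * K * L = 2 * L + 4 * (L / L0) := by rw [hK]; ring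
      linarith
    calc 4 * Real.exp (-2 * B * (K * √(L / B)) ^ 2)
        ≤ Real.exp 4 * Real.exp (-2 * K ^ 2 * L) := by
          rw [e1]
          gcongr
          linarith [Real.add_one_le_exp 4]
      _ ≤ δ := by
          rw [← Real.exp_add, e2]
          exact Real.exp_le_exp.2 (by linarith)
  have hcompl := measureReal_union_le (μ := P)
    {ω | |empCVaR α (fun i => X (ξ i ω)) - CVaR α X μ| ≤ 2 * K * (Jmax / (1 - α) * √(L / B))}
    {ω | 2 * (Jmax / (1 - α) * (K * √(L / B))) < |empCVaR α (fun i => X (ξ i ω)) - CVaR α X μ|}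
  have huniv : {ω | |empCVaR α (fun i => X (ξ i ω)) - CVaR α X μ| ≤
      2 * K * (Jmax / (1 - α) * √(L / B))} ∪ {ω | 2 * (Jmax / (1 - α) * (K * √(L / B))) <
        |empCVaR α (fun i => X (ξ i ω)) - CVaR α X μ|} = Set.univ := by
    ext ω
    have : 2 * K * (Jmax / (1 - α) * √(L / B)) = 2 * (Jmax / (1 - α) * (K * √(L / B))) := by ring
    simp only [Set.mem_union, Set.mem_ofPred_eq, this, Set.mem_univ, iff_true]
    exact le_or_gt _ _
  rw [huniv, probReal_univ] at hcompl
  linarith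

end Value

/-! ### Boundedness in probability -/

section BigOInProb

lemma isBigOInProb_of_eventually_le {Ω E : Type*} [MeasurableSpace Ω] {P : Measure Ω} [Norm E]
    {r : ℕ → ℝ} {X : ℕ → Ω → E} (h : ∀ᶠ n in atTop, ∀ ω, ‖X n ω‖ ≤ r n) :
    IsBigOInProb P X r := by
  intro ε hε
  refine ⟨1, h.mono fun n hn => ?_⟩
  have : {ω | 1 * r n < ‖X n ω‖} = ∅ := by
    ext ω; simpa using hn ω
  rw [this, measureReal_empty]
  exact hε.le

variable {Ω : Type*} [MeasurableSpace Ω] {P : Measure Ω} [IsFiniteMeasure P]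
  {E F : Type*} [SeminormedAddCommGroup E] [SeminormedAddCommGroup F] {r : ℕ → ℝ}

lemma IsBigOInProb.add {X Y : ℕ → Ω → E} (hX : IsBigOInProb P X r) (hY : IsBigOInProb P Y r) :
    IsBigOInProb P (fun n ω => X n ω + Y n ω) r := by
  intro ε hε
  obtain ⟨M, hM⟩ := hX (ε / 2) (half_pos hε)
  obtain ⟨N, hN⟩ := hY (ε / 2) (half_pos hε)
  refine ⟨M + N, ?_⟩
  filter_upwards [hM, hN] with n h1 h2
  rw [← add_halves ε]
  refine le_trans (measureReal_mono ?_) ((measureReal_union_le _ _).trans (add_le_add h1 h2))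
  intro ω hω
  by_contra hcon
  simp only [Set.mem_union, Set.mem_ofPred_eq, not_or, not_lt] at hcon hω
  linarith [norm_add_le (X n ω) (Y n ω), add_mul M N (r n)]

lemma IsBigOInProb.sum {ι : Type*} {X : ι → ℕ → Ω → E} (s : Finset ι)
    (hX : ∀ k ∈ s, IsBigOInProb P (X k) r) : IsBigOInProb P (fun n ω => ∑ k ∈ s, X k n ω) r := by
  classical
  induction s using Finset.induction_on with
  | empty => exact fun ε hε => ⟨0, .of_forall fun n => by simpa using hε.le⟩
  | insert k s hk ih =>
    simp only [Finset.sum_insert hk]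
    exact (hX k (by simp)).add (ih fun j hj => hX j (by simp [hj]))

/-- Domination up to a constant, on events whose probability tends to one. -/
lemma IsBigOInProb.of_norm_le {X : ℕ → Ω → E} {Y : ℕ → Ω → F} (hY : IsBigOInProb P Y r)
    {S : ℕ → Set Ω} (hS : Tendsto (fun n => P.real (S n)ᶜ) atTop (𝓝 0)) {c : ℝ} (hc : 0 < c)
    (h : ∀ᶠ n in atTop, ∀ ω ∈ S n, ‖X n ω‖ ≤ c * ‖Y n ω‖) : IsBigOInProb P X r := by
  intro ε hε
  obtain ⟨M, hM⟩ := hY (ε / 2) (half_pos hε)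
  refine ⟨c * M, ?_⟩
  filter_upwards [hM, hS.eventually (gt_mem_nhds (half_pos hε)), h] with n h1 h2 h3
  rw [← add_halves ε]
  refine le_trans (measureReal_mono ?_) ((measureReal_union_le _ _).trans (add_le_add h1 h2.le))
  intro ω hω
  by_contra hcon
  simp only [Set.mem_union, Set.mem_ofPred_eq, not_or, not_lt, Set.mem_compl_iff, not_not]
    at hcon hω
  have h4 := h3 ω hcon.2
  have h5 := mul_le_mul_of_nonneg_left hcon.1 hc.le
  linarith [mul_assoc c M (r n)]

end BigOInProb

/-! ### Sample means along an infinite i.i.d. sequence -/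

section SampleMean

variable {Ξ Ω : Type*} [MeasurableSpace Ξ] [MeasurableSpace Ω] {μ : Measure Ξ} {P : Measure Ω}
  {ξ : ℕ → Ω → Ξ}

lemma tendsto_mean_ae {E : Type*} [NormedAddCommGroup E] [NormedSpace ℝ E] [CompleteSpace E]
    [MeasurableSpace E] [BorelSpace E] [SecondCountableTopology E]
    (hξ : ∀ i, HasLaw (ξ i) μ P) (hind : iIndepFun ξ P) {h : Ξ → E} (hi : Integrable h μ) :
    ∀ᵐ ω ∂P, Tendsto (fun B : ℕ => (1 / (B : ℝ)) • ∑ i : Fin B, h (ξ i ω)) atTop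
      (𝓝 (∫ x, h x ∂μ)) := by
  have hm : ∀ i, AEMeasurable h (P.map (ξ i)) := fun i => by
    rw [(hξ i).map_eq]; exact hi.aestronglyMeasurable.aemeasurable
  have hint : Integrable (h ∘ ξ 0) P :=
    Integrable.comp_aemeasurable (by rwa [(hξ 0).map_eq]) (hξ 0).aemeasurable
  have hlaw := strong_law_ae (fun i => h ∘ ξ i) hint
    (fun i j hij => (hind.indepFun hij).comp₀ (hξ i).aemeasurable (hξ j).aemeasurable (hm i) (hm j))
    (fun i => IdentDistrib.comp_of_aemeasurable
      ⟨(hξ i).aemeasurable, (hξ 0).aemeasurable, by rw [(hξ i).map_eq, (hξ 0).map_eq]⟩ (hm i))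
  filter_upwards [hlaw] with ω hω
  rw [(hξ 0).integral_comp hi.aestronglyMeasurable] at hω
  refine hω.congr fun n => ?_
  rw [one_div, Finset.sum_range]
  rfl

variable [IsProbabilityMeasure P]

lemma isBigOInProb_mean_real (hξ : ∀ i, HasLaw (ξ i) μ P) (hind : iIndepFun ξ P) {h : Ξ → ℝ}
    (hm : AEMeasurable h μ) {a b : ℝ} (hab : ∀ᵐ x ∂μ, h x ∈ Set.Icc a b) :
    IsBigOInProb P (fun (B : ℕ) ω => 1 / (B : ℝ) * ∑ i : Fin B, h (ξ i ω) - ∫ x, h x ∂μ)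
      (fun B : ℕ => (B : ℝ) ^ (-(1 / 2) : ℝ)) := by
  intro ε hε
  obtain ⟨x, hx, hx0⟩ := ((Real.tendsto_exp_neg_atTop_nhds_zero.eventually
    (gt_mem_nhds (half_pos hε))).and (eventually_ge_atTop 0)).exists
  refine ⟨(b - a) * √x, ?_⟩
  filter_upwards [eventually_gt_atTop 0] with B hB
  have hB' : (0 : ℝ) < B := by exact_mod_cast hB
  have hs : 0 ≤ √x * (B : ℝ) ^ (-(1 / 2) : ℝ) := by positivity
  have h1 := measureReal_abs_mean_sub_gt_le hB (fun i : Fin B => hξ i)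
    (hind.precomp Fin.val_injective) hm hab hs
  have h2 : -2 * B * (√x * (B : ℝ) ^ (-(1 / 2) : ℝ)) ^ 2 = -2 * x := by
    rw [mul_pow, Real.sq_sqrt hx0, ← Real.rpow_natCast, ← Real.rpow_mul hB'.le]
    norm_num
    rw [Real.rpow_neg_one]
    field_simp
  rw [h2] at h1
  have h3 : Real.exp (-2 * x) ≤ Real.exp (-x) := Real.exp_le_exp.2 (by linarith)
  simp only [Real.norm_eq_abs]
  rw [mul_assoc (b - a)]
  linarith

lemma isBigOInProb_mean {E : Type*} [NormedAddCommGroup E] [InnerProductSpace ℝ E]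
    [FiniteDimensional ℝ E] (hξ : ∀ i, HasLaw (ξ i) μ P) (hind : iIndepFun ξ P) {h : Ξ → E}
    (hi : Integrable h μ) {G : ℝ} (hG : ∀ᵐ x ∂μ, ‖h x‖ ≤ G) :
    IsBigOInProb P (fun (B : ℕ) ω => (1 / (B : ℝ)) • ∑ i : Fin B, h (ξ i ω) - ∫ x, h x ∂μ)
      (fun B : ℕ => (B : ℝ) ^ (-(1 / 2) : ℝ)) := by
  let b := stdOrthonormalBasis ℝ E
  have hk : ∀ k, IsBigOInProb P (fun (B : ℕ) ω => |1 / (B : ℝ) * ∑ i : Fin B,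
      inner ℝ (b k) (h (ξ i ω)) - ∫ x, inner ℝ (b k) (h x) ∂μ|)
      (fun B : ℕ => (B : ℝ) ^ (-(1 / 2) : ℝ)) := by
    intro k ε hε
    simp only [Real.norm_eq_abs, abs_abs]
    refine isBigOInProb_mean_real hξ hind (h := fun x => inner ℝ (b k) (h x)) (a := -G) (b := G)
      (hi.const_inner (b k)).aestronglyMeasurable.aemeasurable
      (hG.mono fun x hx => abs_le.1 ?_) ε hε
    refine (abs_real_inner_le_norm _ _).trans ?_
    rwa [b.norm_eq_one, one_mul]
  refine (IsBigOInProb.sum Finset.univ fun k _ => hk k).of_norm_le (S := fun _ => Set.univ)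
    (by simp) one_pos (.of_forall fun B ω _ => ?_)
  set v := (1 / (B : ℝ)) • ∑ i : Fin B, h (ξ i ω) - ∫ x, h x ∂μ with hv
  have hin : ∀ k, 1 / (B : ℝ) * ∑ i : Fin B, inner ℝ (b k) (h (ξ i ω)) -
      ∫ x, inner ℝ (b k) (h x) ∂μ = inner ℝ (b k) v := by
    intro k
    rw [hv, inner_sub_right, inner_smul_right, inner_sum, integral_inner hi]
  simp only [hin]
  rw [one_mul, Real.norm_of_nonneg (Finset.sum_nonneg fun _ _ => abs_nonneg _)]
  calc ‖v‖ = ‖∑ k, inner ℝ (b k) v • b k‖ := by rw [b.sum_repr']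
    _ ≤ ∑ k, ‖inner ℝ (b k) v • b k‖ := norm_sum_le _ _
    _ = _ := by simp [norm_smul, b.norm_eq_one]

end SampleMean

/-! ### Absence of ties -/

section Ties

variable {Ω : Type*} [MeasurableSpace Ω] {P : Measure Ω} [IsProbabilityMeasure P] {X Y : Ω → ℝ}

lemma ProbabilityTheory.IndepFun.ae_eq_imp_notMem (hXY : IndepFun X Y P) (hX : AEMeasurable X P)
    (hY : AEMeasurable Y P) {S : Set ℝ} (hS : MeasurableSet S)
    (h : ∀ x ∈ S, P.map Y {x} = 0) : ∀ᵐ ω ∂P, X ω = Y ω → X ω ∉ S := by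
  have hYp := Measure.isProbabilityMeasure_map hY
  have hD : MeasurableSet {p : ℝ × ℝ | p.1 = p.2 ∧ p.1 ∈ S} :=
    (measurableSet_eq_fun measurable_fst measurable_snd).inter (measurable_fst hS)
  have h0 : P.map (fun ω => (X ω, Y ω)) {p : ℝ × ℝ | p.1 = p.2 ∧ p.1 ∈ S} = 0 := by
    rw [hXY.map_prod_eq_prod_map_map hX hY, Measure.prod_apply hD, lintegral_eq_zero_iff
      (measurable_measure_prodMk_left hD)]
    refine ae_of_all _ fun x => ?_
    by_cases hx : x ∈ S
    · exact measure_mono_null (fun y hy => hy.1.symm) (h x hx)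
    · exact measure_mono_null (fun y hy => hx hy.2) measure_empty
  rw [Measure.map_apply_of_aemeasurable (hX.prodMk hY) hD] at h0
  rw [ae_iff]
  convert h0 using 2
  ext ω
  simp

lemma HasContinuousDensityNear.exists_singleton_eq_zero {ν : Measure ℝ} {x : ℝ}
    (h : HasContinuousDensityNear ν x) :
    ∃ ε > 0, ∀ t ∈ Set.Ioo (x - ε) (x + ε), ν {t} = 0 := by
  obtain ⟨ε, hε, f, -, -, hf⟩ := h
  refine ⟨ε, hε, fun t ht => ?_⟩
  rw [hf {t} (by simpa using ht) (measurableSet_singleton t)]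
  simp

end Ties

/-! ### Counting sample points below the empirical quantile -/

section Counting

variable {B : ℕ} {α : ℝ}

/-- Moving a threshold changes a sum over the tail by at most the number of points crossed. -/
lemma norm_sum_tail_sub_le {E : Type*} [SeminormedAddCommGroup E] {ι : Type*} [Fintype ι]
    (x : ι → ℝ) {g : ι → E} {G : ℝ} (hg : ∀ i, ‖g i‖ ≤ G) (s t : ℝ) :
    ‖(∑ i, if s ≤ x i then g i else 0) - ∑ i, if t ≤ x i then g i else 0‖ ≤
      G * |((Finset.univ.filter fun i => x i < s).card : ℝ) -
        (Finset.univ.filter fun i => x i < t).card| := by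
  wlog hst : s ≤ t generalizing s t
  · rw [norm_sub_rev, abs_sub_comm]
    exact this t s (le_of_not_ge hst)
  have hcard : ((Finset.univ.filter fun i => x i < t).card : ℝ) -
      (Finset.univ.filter fun i => x i < s).card =
      ∑ i, if s ≤ x i ∧ x i < t then (1 : ℝ) else 0 := by
    rw [Finset.card_filter, Finset.card_filter]
    push_cast
    rw [← Finset.sum_sub_distrib]
    refine Finset.sum_congr rfl fun i _ => ?_
    rcases lt_or_ge (x i) s with h | h
    · simp [h, h.trans_le hst, h.not_ge]
    · simp [h, h.not_gt]
  rw [abs_sub_comm, hcard, abs_of_nonneg (Finset.sum_nonneg fun i _ => by positivity),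
    Finset.mul_sum, ← Finset.sum_sub_distrib]
  refine norm_sum_le_of_le _ fun i _ => ?_
  rcases lt_or_ge (x i) s with h | h
  · simp [h.not_ge, (h.trans_le hst).not_ge]
  · rcases lt_or_ge (x i) t with h' | h'
    · simpa [h, h', h'.not_ge] using hg i
    · simp [h, h', h'.not_gt]

/-- If the sample has no ties just below `q`, the number of points below the empirical quantile is
as close to that below `q` as the latter is to `α B`, up to one. Ties above `q` are harmless, since
at most `α B` points lie strictly below the empirical quantile. -/
lemma abs_card_lt_empQuantile_sub_le (hα : 0 < α) (hα1 : α < 1) (hB : 0 < B) {x : Fin B → ℝ}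
    {c q : ℝ} (hties : ∀ i j, i ≠ j → x i = x j → x i ∉ Set.Ioo c q)
    (hc : ((Finset.univ.filter fun i => x i ≤ c).card : ℝ) < α * B) :
    |((Finset.univ.filter fun i => x i < empQuantile α x).card : ℝ) -
        (Finset.univ.filter fun i => x i < q).card| ≤
      |((Finset.univ.filter fun i => x i < q).card : ℝ) - α * B| + 1 := by
  set η := empQuantile α x with hη
  have h1 : α * B ≤ (Finset.univ.filter fun i => x i ≤ η).card := le_card_le_empQuantile hα1 hB x
  have h2 : ((Finset.univ.filter fun i => x i < η).card : ℝ) ≤ α * B :=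
    card_lt_empQuantile_le hα hB x
  have mono : ∀ p p' : Fin B → Prop, ∀ [DecidablePred p] [DecidablePred p'], (∀ i, p i → p' i) →
      ((Finset.univ.filter p).card : ℝ) ≤ (Finset.univ.filter p').card := by
    intro p p' _ _ h
    exact_mod_cast Finset.card_le_card (Finset.monotone_filter_right _ fun i _ => h i)
  have hcη : c < η := by
    by_contra! h
    exact absurd (h1.trans (mono _ _ fun i hi => hi.trans h)) (not_le.2 hc)
  rcases le_or_gt q η with hqη | hqη
  · have h3 := mono (fun i => x i < q) (fun i => x i < η) fun i hi => hi.trans_le hqη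
    have h4 := neg_abs_le (((Finset.univ.filter fun i => x i < q).card : ℝ) - α * B)
    rw [abs_of_nonneg (by linarith)]
    linarith
  · have h3 := mono (fun i => x i < η) (fun i => x i < q) fun i hi => hi.trans hqη
    have h4 := le_abs_self (((Finset.univ.filter fun i => x i < q).card : ℝ) - α * B)
    have h5 : (Finset.univ.filter fun i => x i = η).card ≤ 1 := by
      refine Finset.card_le_one.2 fun i hi j hj => ?_
      simp only [Finset.mem_filter, Finset.mem_univ, true_and] at hi hj
      by_contra hij
      exact hties i j hij (hi.trans hj.symm) (by rw [hi]; exact ⟨hcη, hqη⟩)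
    have h6 : (Finset.univ.filter fun i => x i ≤ η).card ≤
        (Finset.univ.filter fun i => x i < η).card +
          (Finset.univ.filter fun i => x i = η).card := by
      refine le_trans (Finset.card_le_card ?_) (Finset.card_union_le _ _)
      intro i hi
      simpa [le_iff_lt_or_eq] using hi
    have h7 : ((Finset.univ.filter fun i => x i ≤ η).card : ℝ) ≤
        (Finset.univ.filter fun i => x i < η).card + 1 := by exact_mod_cast h6.trans (by omega)
    rw [abs_sub_comm, abs_of_nonneg (by linarith)]
    linarith

end Counting

/-! ### The tail mean cut off at the empirical quantile -/

section Estimator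

variable {E : Type*} [NormedAddCommGroup E] {α : ℝ}

/-- The estimator differs from the sample mean with the true quantile `q` by the fluctuation of the
number of points below `q`. -/
lemma norm_tailMean_sub_le [NormedSpace ℝ E] (hα : 0 < α) (hα1 : α < 1) {B : ℕ} (hB : 0 < B)
    {x : Fin B → ℝ} {g : Fin B → E} {G : ℝ} (hg : ∀ i, ‖g i‖ ≤ G) {c q : ℝ}
    (hties : ∀ i j, i ≠ j → x i = x j → x i ∉ Set.Ioo c q)
    (hc : 1 / (B : ℝ) * ∑ i, (if x i ≤ c then (1 : ℝ) else 0) < α) (e : E) :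
    ‖(1 / ((1 - α) * B)) • (∑ i, if empQuantile α x ≤ x i then g i else 0) - (1 / (1 - α)) • e‖ ≤
      (1 + G) / (1 - α) * (‖(1 / (B : ℝ)) • (∑ i, if q ≤ x i then g i else 0) - e‖ +
        (|1 / (B : ℝ) * (∑ i, if x i < q then (1 : ℝ) else 0) - α| + 1 / B)) := by
  have hB' : (0 : ℝ) < B := by exact_mod_cast hB
  have hα' : 0 < 1 - α := by linarith
  have hG : 0 ≤ G := (norm_nonneg _).trans (hg ⟨0, hB⟩)
  rw [Finset.sum_boole] at hc ⊢
  have hc' : ((Finset.univ.filter fun i => x i ≤ c).card : ℝ) < α * B := by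
    rwa [one_div, inv_mul_lt_iff₀ hB', mul_comm] at hc
  have h1 := norm_sum_tail_sub_le x hg (empQuantile α x) q
  have h2 := abs_card_lt_empQuantile_sub_le hα hα1 hB hties hc'
  set N : ℝ := ((Finset.univ.filter fun i => x i < q).card : ℝ)
  set S := ∑ i, if empQuantile α x ≤ x i then g i else 0
  set T := ∑ i, if q ≤ x i then g i else 0
  have h3 : ‖S - T‖ ≤ G * (|N - α * B| + 1) := h1.trans (mul_le_mul_of_nonneg_left h2 hG)
  have h4 : |N - α * B| = B * |1 / (B : ℝ) * N - α| := by
    rw [← abs_of_pos hB', ← abs_mul, abs_of_pos hB']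
    congr 1
    field_simp
  have h5 : (1 / ((1 - α) * B)) • S - (1 / (1 - α)) • e =
      (1 / (1 - α)) • (((1 / (B : ℝ)) • T - e) + (1 / (B : ℝ)) • (S - T)) := by
    rw [← one_div_mul_one_div, mul_smul, ← smul_sub, smul_sub (1 / (B : ℝ))]
    congr 1
    abel
  have h6 : ‖(1 / (B : ℝ)) • (S - T)‖ ≤ G * (|1 / (B : ℝ) * N - α| + 1 / B) := by
    rw [norm_smul, Real.norm_of_nonneg (by positivity)]
    calc 1 / (B : ℝ) * ‖S - T‖ ≤ 1 / (B : ℝ) * (G * (|N - α * B| + 1)) := by gcongr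
      _ = _ := by rw [h4]; field_simp
  rw [h5, norm_smul, Real.norm_of_nonneg (by positivity), div_eq_mul_one_div (1 + G),
    mul_comm (1 + G), mul_assoc]
  refine mul_le_mul_of_nonneg_left ((norm_add_le _ _).trans ?_) (by positivity)
  have h7 : 0 ≤ |1 / (B : ℝ) * N - α| + 1 / B := by positivity
  have h8 : 0 ≤ G * ‖(1 / (B : ℝ)) • T - e‖ := by positivity
  linarith

variable {Ξ Ω : Type*} [MeasurableSpace Ξ] [MeasurableSpace Ω] {μ : Measure Ξ} {P : Measure Ω}
  [IsProbabilityMeasure μ] [IsProbabilityMeasure P] {ξ : ℕ → Ω → Ξ}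

/-- Almost sure convergence and `B ^ (-1/2)` rate of the tail mean cut off at the empirical
quantile. -/
theorem tailMean_tendsto_ae_and_isBigOInProb [InnerProductSpace ℝ E] [FiniteDimensional ℝ E]
    (hα : 0 < α) (hα1 : α < 1) {X : Ξ → ℝ} (hX : Measurable X) {g : Ξ → E}
    (hg : AEStronglyMeasurable g μ) {G : ℝ} (hG : ∀ᵐ x ∂μ, ‖g x‖ ≤ G)
    (hdens : HasContinuousDensityNear (μ.map X) (VaR α X μ)) (hq : μ {x | X x = VaR α X μ} = 0)
    (hξ : ∀ i, HasLaw (ξ i) μ P) (hind : iIndepFun ξ P) :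
    (∀ᵐ ω ∂P, Tendsto (fun B : ℕ => (1 / ((1 - α) * B)) • ∑ i : Fin B,
        if empQuantile α (fun j : Fin B => X (ξ j ω)) ≤ X (ξ i ω) then g (ξ i ω) else 0) atTop
      (𝓝 ((1 / (1 - α)) • ∫ x, {x | VaR α X μ ≤ X x}.indicator g x ∂μ))) ∧
    IsBigOInProb P (fun (B : ℕ) ω => (1 / ((1 - α) * B)) • (∑ i : Fin B,
        if empQuantile α (fun j : Fin B => X (ξ j ω)) ≤ X (ξ i ω) then g (ξ i ω) else 0) -
      (1 / (1 - α)) • ∫ x, {x | VaR α X μ ≤ X x}.indicator g x ∂μ)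
      (fun B : ℕ => (B : ℝ) ^ (-(1 / 2) : ℝ)) := by
  borelize E
  set q := VaR α X μ with hqdef
  obtain ⟨ε, hε, hatom⟩ := hdens.exists_singleton_eq_zero
  set c := q - ε with hcdef
  have hmc : MeasurableSet {x | X x ≤ c} := measurableSet_le hX measurable_const
  have hmq : MeasurableSet {x | X x < q} := measurableSet_lt hX measurable_const
  have hmt : MeasurableSet {x | q ≤ X x} := measurableSet_le measurable_const hX
  have hp : μ.real {x | X x ≤ c} < α := real_le_lt_of_lt_VaR hX hα (by linarith)
  have hpq : μ.real {x | X x < q} = α := by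
    refine (real_lt_VaR_le hX hα).antisymm ?_
    have h1 : {x | X x ≤ q} ⊆ {x | X x < q} ∪ {x | X x = q} := fun x hx =>
      (le_iff_lt_or_eq (a := X x)).1 hx
    have h2 : μ.real {x | X x = q} = 0 := by rw [measureReal_def, hq, ENNReal.toReal_zero]
    have h3 : α ≤ μ.real {x | X x ≤ q} := le_real_le_VaR hX hα1
    linarith [(measureReal_mono h1).trans (measureReal_union_le (μ := μ) _ _)]
  set fc : Ξ → ℝ := fun x => if X x ≤ c then 1 else 0 with hfc
  set fq : Ξ → ℝ := fun x => if X x < q then 1 else 0 with hfq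
  set ft : Ξ → E := fun x => if q ≤ X x then g x else 0 with hft
  have hft_eq : {x | q ≤ X x}.indicator g = ft := by
    ext x; simp [hft, Set.indicator_apply]
  have hcm : Measurable fc := Measurable.ite hmc measurable_const measurable_const
  have hqm : Measurable fq := Measurable.ite hmq measurable_const measurable_const
  have h01c : ∀ᵐ x ∂μ, fc x ∈ Set.Icc (0 : ℝ) 1 := ae_of_all _ fun x => by
    simp only [hfc]; split_ifs <;> simp
  have h01q : ∀ᵐ x ∂μ, fq x ∈ Set.Icc (0 : ℝ) 1 := ae_of_all _ fun x => by
    simp only [hfq]; split_ifs <;> simp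
  have hic : ∫ x, fc x ∂μ = μ.real {x | X x ≤ c} := by
    rw [← integral_indicator_one hmc]; congr 1
  have hiq : ∫ x, fq x ∂μ = α := by
    rw [← hpq, ← integral_indicator_one hmq]; congr 1
  have hGt : ∀ᵐ x ∂μ, ‖ft x‖ ≤ G := hG.mono fun x hx => by
    simp only [hft]
    split_ifs
    · exact hx
    · simpa using (norm_nonneg _).trans hx
  have hit : Integrable ft μ := by
    refine (integrable_const G).mono' ?_ hGt
    rw [← hft_eq]
    exact hg.indicator hmt
  have hG0 : 0 ≤ G := by
    obtain ⟨x, hx⟩ := hG.exists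
    exact (norm_nonneg _).trans hx
  -- the almost sure properties of the sample: bounded gradients and no ties just below `q`
  set T : Set Ω := {ω | (∀ i, ‖g (ξ i ω)‖ ≤ G) ∧
    ∀ i j, i ≠ j → X (ξ i ω) = X (ξ j ω) → X (ξ i ω) ∉ Set.Ioo c q} with hT
  have hTae : ∀ᵐ ω ∂P, ω ∈ T := by
    have h1 : ∀ᵐ ω ∂P, ∀ i, ‖g (ξ i ω)‖ ≤ G := ae_all_iff.2 fun i =>
      ae_of_ae_map (hξ i).aemeasurable (by rw [(hξ i).map_eq]; exact hG)
    have h2 : ∀ᵐ ω ∂P, ∀ i j, i ≠ j → X (ξ i ω) = X (ξ j ω) → X (ξ i ω) ∉ Set.Ioo c q := by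
      refine ae_all_iff.2 fun i => ae_all_iff.2 fun j => ?_
      by_cases hij : i = j
      · exact ae_of_all _ fun ω h => absurd hij h
      have hmeas : ∀ k, AEMeasurable (fun ω => X (ξ k ω)) P := fun k =>
        hX.comp_aemeasurable (hξ k).aemeasurable
      refine (((hind.indepFun hij).comp hX hX).ae_eq_imp_notMem (hmeas i) (hmeas j)
        (S := Set.Ioo c q) measurableSet_Ioo fun x hx => ?_).mono fun ω h _ => h
      have hmap : P.map (X ∘ ξ j) = μ.map X := by
        rw [← AEMeasurable.map_map_of_aemeasurable hX.aemeasurable (hξ j).aemeasurable,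
          (hξ j).map_eq]
      rw [hmap]
      exact hatom x ⟨hx.1, hx.2.trans (by linarith)⟩
    filter_upwards [h1, h2] with ω h1 h2 using ⟨h1, h2⟩
  have hbound : ∀ B : ℕ, 0 < B → ∀ ω ∈ T, 1 / (B : ℝ) * ∑ i : Fin B, fc (ξ i ω) < α →
      ‖(1 / ((1 - α) * B)) • (∑ i : Fin B,
        if empQuantile α (fun j : Fin B => X (ξ j ω)) ≤ X (ξ i ω) then g (ξ i ω) else 0) -
          (1 / (1 - α)) • ∫ x, {x | q ≤ X x}.indicator g x ∂μ‖ ≤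
      (1 + G) / (1 - α) * (‖(1 / (B : ℝ)) • (∑ i : Fin B, ft (ξ i ω)) - ∫ x, ft x ∂μ‖ +
        (|1 / (B : ℝ) * (∑ i : Fin B, fq (ξ i ω)) - ∫ x, fq x ∂μ| + 1 / B)) := by
    intro B hB ω hω hcω
    rw [hft_eq, hiq]
    exact norm_tailMean_sub_le hα hα1 hB (x := fun i : Fin B => X (ξ i ω))
      (g := fun i : Fin B => g (ξ i ω)) (fun i => hω.1 i)
      (fun i j hij => hω.2 i j (Fin.val_injective.ne hij)) hcω _
  have hK : 0 < (1 + G) / (1 - α) := div_pos (by linarith) (by linarith)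
  refine ⟨?_, ?_⟩
  · filter_upwards [hTae, tendsto_mean_ae hξ hind hit,
      tendsto_mean_ae hξ hind (Integrable.of_mem_Icc 0 1 hqm.aemeasurable h01q),
      tendsto_mean_ae hξ hind (Integrable.of_mem_Icc 0 1 hcm.aemeasurable h01c)]
      with ω hω ht hq' hc'
    rw [hic] at hc'
    rw [tendsto_iff_norm_sub_tendsto_zero]
    have hlim := (((tendsto_iff_norm_sub_tendsto_zero.1 ht).add
      ((tendsto_iff_norm_sub_tendsto_zero.1 hq').add
        (tendsto_one_div_atTop_nhds_zero_nat (𝕜 := ℝ)))).const_mul ((1 + G) / (1 - α)))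
    simp only [add_zero, mul_zero] at hlim
    refine squeeze_zero' (.of_forall fun _ => norm_nonneg _) ?_ hlim
    filter_upwards [eventually_gt_atTop 0, hc'.eventually (gt_mem_nhds hp)] with B hB hcB
    exact hbound B hB ω hω hcB
  · have hO1 : IsBigOInProb P (fun (B : ℕ) ω =>
        ‖(1 / (B : ℝ)) • (∑ i : Fin B, ft (ξ i ω)) - ∫ x, ft x ∂μ‖)
        (fun B : ℕ => (B : ℝ) ^ (-(1 / 2) : ℝ)) := fun η hη => by
      simpa only [norm_norm] using isBigOInProb_mean hξ hind hit hGt η hη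
    have hO2 : IsBigOInProb P (fun (B : ℕ) ω =>
        |1 / (B : ℝ) * (∑ i : Fin B, fq (ξ i ω)) - ∫ x, fq x ∂μ|)
        (fun B : ℕ => (B : ℝ) ^ (-(1 / 2) : ℝ)) := fun η hη => by
      simpa only [Real.norm_eq_abs, abs_abs] using
        isBigOInProb_mean_real hξ hind hqm.aemeasurable h01q η hη
    have hO3 : IsBigOInProb P (fun (B : ℕ) (_ : Ω) => 1 / (B : ℝ))
        (fun B : ℕ => (B : ℝ) ^ (-(1 / 2) : ℝ)) := by
      refine isBigOInProb_of_eventually_le ?_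
      filter_upwards [eventually_ge_atTop 1] with B hB ω
      have hB' : (1 : ℝ) ≤ B := by exact_mod_cast hB
      rw [Real.norm_of_nonneg (by positivity), one_div, ← Real.rpow_neg_one]
      exact Real.rpow_le_rpow_of_exponent_le hB' (by norm_num)
    refine (hO1.add (hO2.add hO3)).of_norm_le
      (S := fun B : ℕ => {ω | ω ∈ T ∧ 1 / (B : ℝ) * ∑ i : Fin B, fc (ξ i ω) < α}) ?_ hK ?_
    · -- Hoeffding with half of the gap between `α` and the mass below `c`
      set s := (α - μ.real {x | X x ≤ c}) / 2 with hs
      have hs0 : 0 < s := by linarith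
      have hT0 : P.real Tᶜ = 0 := by
        rw [measureReal_def, ENNReal.toReal_eq_zero_iff]
        exact .inl (ae_iff.1 hTae)
      have hexp : Tendsto (fun B : ℕ => 2 * Real.exp (-2 * B * s ^ 2)) atTop (𝓝 0) := by
        have h1 : Tendsto (fun B : ℕ => 2 * s ^ 2 * (B : ℝ)) atTop atTop :=
          tendsto_natCast_atTop_atTop.const_mul_atTop (by positivity)
        have h2 := (Real.tendsto_exp_neg_atTop_nhds_zero.comp h1).const_mul 2
        rw [mul_zero] at h2
        refine h2.congr fun B => ?_
        simp only [Function.comp_apply]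
        congr 2
        ring
      refine squeeze_zero' (.of_forall fun _ => measureReal_nonneg) ?_ hexp
      filter_upwards [eventually_gt_atTop 0] with B hB
      have hh := measureReal_abs_mean_sub_gt_le hB (fun i : Fin B => hξ i)
        (hind.precomp Fin.val_injective) hcm.aemeasurable h01c hs0.le
      rw [← zero_add (2 * Real.exp _), ← hT0]
      refine le_trans (measureReal_mono ?_) ((measureReal_union_le _ _).trans
        (add_le_add le_rfl hh))
      intro ω hω
      by_cases hωT : ω ∈ T
      · have h1 : α ≤ 1 / (B : ℝ) * ∑ i : Fin B, fc (ξ i ω) := by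
          by_contra! h
          exact hω ⟨hωT, h⟩
        refine .inr ?_
        rw [Set.mem_ofPred_eq, hic]
        exact lt_of_lt_of_le (by linarith) (le_abs_self _)
      · exact .inl hωT
    · filter_upwards [eventually_gt_atTop 0] with B hB ω hω
      refine (hbound B hB ω hω.1 hω.2).trans_eq ?_
      rw [Real.norm_of_nonneg]
      positivity

end Estimator

theorem mainTheorem2 :
    (∀ (d : ℕ) (Ξ : Type*) [MeasurableSpace Ξ] (μ : Measure Ξ) [IsProbabilityMeasure μ]
        (J : EuclideanSpace ℝ (Fin d) → Ξ → ℝ) (Θ : Set (EuclideanSpace ℝ (Fin d)))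
        (θ : EuclideanSpace ℝ (Fin d)) (α G : ℝ),
        IsOpen Θ → θ ∈ Θ → 0 < α → α < 1 →
        (∀ τ ∈ Θ, Measurable (J τ)) →
        Integrable (fun ξ => max (J θ ξ) 0) μ →
        (∀ᵐ ξ ∂μ, ∀ τ ∈ Θ, DifferentiableAt ℝ (fun τ' => J τ' ξ) τ) →
        (∀ᵐ ξ ∂μ, ∀ τ ∈ Θ, ‖gradient (fun τ' => J τ' ξ) τ‖ ≤ G) →
        HasContinuousDensityNear (μ.map (J θ)) (VaR α (J θ) μ) →
        μ {ξ | J θ ξ = VaR α (J θ) μ} = 0 →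
        -- the gradient formula
        (Integrable ({ξ | VaR α (J θ) μ ≤ J θ ξ}.indicator
            fun ξ => gradient (fun τ => J τ ξ) θ) μ ∧
          HasGradientAt (fun τ => CVaR α (J τ) μ)
            ((1 / (1 - α)) • ∫ ξ, {ξ | VaR α (J θ) μ ≤ J θ ξ}.indicator
              (fun ξ => gradient (fun τ => J τ ξ) θ) ξ ∂μ) θ) ∧
        -- strong consistency and rate of the estimator along i.i.d. rollouts
        ∀ (Ω : Type*) [MeasurableSpace Ω] (P : Measure Ω) [IsProbabilityMeasure P]
          (ξ : ℕ → Ω → Ξ), (∀ i, HasLaw (ξ i) μ P) → iIndepFun ξ P →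
          (∀ᵐ ω ∂P, Tendsto
            (fun B : ℕ => tailGradEstimator α J θ (fun i : Fin B => ξ i ω)) atTop
            (𝓝 (gradient (fun τ => CVaR α (J τ) μ) θ))) ∧
          IsBigOInProb P
            (fun (B : ℕ) ω => tailGradEstimator α J θ (fun i : Fin B => ξ i ω) -
              gradient (fun τ => CVaR α (J τ) μ) θ)
            (fun B : ℕ => (B : ℝ) ^ (-(1 / 2) : ℝ))) ∧
    -- concentration of the empirical CVaR value of a bounded cost `X = J_θ`;
    -- the constant `C` depends on `δ₀` only
    (∀ δ₀ : ℝ, 0 < δ₀ → δ₀ < 1 → ∃ C : ℝ, 0 < C ∧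
      ∀ (Ξ : Type*) [MeasurableSpace Ξ] (μ : Measure Ξ) [IsProbabilityMeasure μ]
        (X : Ξ → ℝ) (α Jmax : ℝ), 0 < α → α < 1 → Measurable X →
        (∀ᵐ ξ ∂μ, X ξ ∈ Set.Icc 0 Jmax) →
        ∀ (Ω : Type*) [MeasurableSpace Ω] (P : Measure Ω) [IsProbabilityMeasure P]
          (B : ℕ) (ξ : Fin B → Ω → Ξ), 0 < B → (∀ i, HasLaw (ξ i) μ P) → iIndepFun ξ P →
          ∀ δ : ℝ, 0 < δ → δ ≤ δ₀ →
            1 - δ ≤ P.real {ω | |empCVaR α (fun i => X (ξ i ω)) - CVaR α X μ| ≤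
              C * (Jmax / (1 - α) * √(Real.log (1 / δ) / B))}) := by
  constructor
  · intro d Ξ _ μ _ J Θ θ α G hΘ hθ hα hα1 hJ hi hd hG hdens hq
    have hgrad := hasGradientAt_CVaR hΘ hθ hα hα1 hJ hi hd hG hq
    refine ⟨hgrad, fun Ω _ P _ ξ hξ hind => ?_⟩
    have hgm := aestronglyMeasurable_gradient (hΘ.mem_nhds hθ)
      (fun τ hτ => (hJ τ hτ).aestronglyMeasurable) (hd.mono fun ξ h => h θ hθ)
    rw [hgrad.2.gradient]
    have hmain := tailMean_tendsto_ae_and_isBigOInProb hα hα1 (hJ θ hθ) hgm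
      (hG.mono fun ξ h => h θ hθ) hdens hq hξ hind
    simp only [tailGradEstimator]
    exact hmain
  · intro δ₀ hδ₀ hδ₀1
    obtain ⟨C, hC, h⟩ := exists_empCVaR_concentration_const hδ₀ hδ₀1
    refine ⟨C, hC, ?_⟩
    intro Ξ _ μ _ X α Jmax hα hα1 hX hXJ Ω _ P _ B ξ hB hξ hind δ hδ hδδ₀
    exact h Ξ μ X α Jmax hα hα1 hX hXJ Ω P B ξ hB hξ hind δ hδ hδδ₀
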